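/- Let $\mathbb B=(\{0,1\},\vee,\wedge,0,1)$ be the Boolean semifield and let $E=(E^0,E^1,s,r)$ be an arbitrary directed graph. A vertex $v$ is a sink if $s^{-1}(v)=\varnothing$, an infinite emitter if $s^{-1}(v)$ is infinite, and regular otherwise; $E$ is row-finite if $s^{-1}(v)$ is finite for every $v\in E^0$. Let $E^*$ be the set of finite paths in $E$ (the vertices are the paths of length $0$); $s(p)$, $r(p)$ and $|p|$ denote the source, the range and the length of a path $p$. The Leavitt path algebra $L_{\mathbb B}(E)$ is the (not necessarily unital) associative $\mathbb B$-algebra generated by the vertices $v\in E^0$, the edges $e\in E^1$ and symbols $e^*$ ($e\in E^1$), subject to the relations: (1) $vw=\delta_{v,w}v$ for $v,w\in E^0$; (2) $s(e)e=e=e\,r(e)$ and $r(e)e^*=e^*=e^*s(e)$ for $e\in E^1$; (3) $e^*f=\delta_{e,f}\,r(e)$ for $e,f\in E^1$; (4) $v=\sum_{e\in s^{-1}(v)}ee^*$ for every regular vertex $v$. Let $X_E$ be the set of all infinite paths in $E$ together with all finite paths whose range is a sink or an infinite emitter. The graph groupoid of $E$ is \[\mathcal G_E=\{(\alpha x,|\alpha|-|\beta|,\beta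 x)\mid \alpha,\beta\in E^*,\ x\in X_E,\ r(\alpha)=s(x)=r(\beta)\},\] with $(x,k,y)(y,l,z)=(x,k+l,z)$ and $(x,k,y)^{-1}=(y,-k,x)$, where $(x,k,y)$ has range $x$ and source $y$. For $\alpha,\beta\in E^*$ with $r(\alpha)=r(\beta)$, put $Z(\alpha,\beta)=\{(\alpha x,|\alpha|-|\beta|,\beta x)\mid x\in X_E,\ s(x)=r(\alpha)\}$; $\mathcal G_E$ carries the topology with base the sets $Z(\alpha,\beta)\setminus\bigcup_{e\in F}Z(\alpha e,\beta e)$, where $F$ is a finite subset of $s^{-1}(r(\alpha))$. The Steinberg algebra $A_{\mathbb B}(\mathcal G_E)$ is the $\mathbb B$-semimodule of functions $\mathcal G_E\to\mathbb B$ spanned by the characteristic functions $1_U$ of the compact open bisections $U$ of $\mathcal G_E$ (the compact open sets $U$ on which source and range are homeomorphisms onto open subsets of the unit space), with the convolution product $(f*g)(\gamma)=\sum_{\gamma=\alpha\beta}f(\alpha)g(\beta)$. Let $\pi_E\colon L_{\mathbb B}(E)\to A_{\mathbb B}(\mathcal G_E)$ be the natural homomorphism, i.e. the unique homomorphism of $\mathbb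 B$-algebras with $\pi_E(v)=1_{Z(v,v)}$, $\pi_E(e)=1_{Z(e,r(e))}$ and $\pi_E(e^*)=1_{Z(r(e),e)}$ for all $v\in E^0$ and $e\in E^1$. Then $\pi_E$ is an isomorphism if and only if $E$ is row-finite. -/

import Mathlib

/-- A directed graph with vertex set `V`, edge set `E`, source map `s` and range map `r`. -/
structure DirGraph (V : Type*) (E : Type*) where
  s : E → V
  r : E → V

namespace DirGraph

open Set Filter Topology

variable {V E : Type*} (G : DirGraph V E)

/-- Every vertex emits only finitely many edges. -/
def RowFinite : Prop := ∀ v : V, (G.s ⁻¹' {v}).Finite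

def IsSink (v : V) : Prop := G.s ⁻¹' {v} = ∅

def IsInfiniteEmitter (v : V) : Prop := (G.s ⁻¹' {v}).Infinite

def IsRegular (v : V) : Prop := (G.s ⁻¹' {v}).Nonempty ∧ (G.s ⁻¹' {v}).Finite

/-- `G.IsPath v l w`: the list `l` of edges is a path from `v` to `w`. -/
def IsPath : V → List E → V → Prop
  | v, [], w => v = w
  | v, e :: l, w => G.s e = v ∧ IsPath (G.r e) l w

variable {G} in
theorem IsPath.tgt_unique {v w w' : V} {l : List E} (h : G.IsPath v l w) (h' : G.IsPath v l w') :
    w = w' := by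
  induction l generalizing v with
  | nil => exact h.symm.trans h'
  | cons e l ih => exact ih h.2 h'.2

theorem isPath_append {v w : V} {l l' : List E} :
    G.IsPath v (l ++ l') w ↔ ∃ u, G.IsPath v l u ∧ G.IsPath u l' w := by
  induction l generalizing v with
  | nil => simp [IsPath]
  | cons e l ih => simp [IsPath, ih, and_assoc]

/-- The set `E^*` of finite paths; the paths of length `0` are the vertices. -/
structure FinPath where
  src : V
  edges : List E
  tgt : V
  isPath : G.IsPath src edges tgt

namespace FinPath

variable {G}

theorem ext' {p q : G.FinPath} (h : p.src = q.src) (h' : p.edges = q.edges) : p = q := by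
  obtain ⟨v, l, w, hp⟩ := p
  obtain ⟨v', l', w', hq⟩ := q
  obtain rfl : v = v' := h
  obtain rfl : l = l' := h'
  obtain rfl := hp.tgt_unique hq
  rfl

def length (p : G.FinPath) : ℕ := p.edges.length

variable (G) in
/-- The path of length `0` at the vertex `v`. -/
abbrev vertex (v : V) : G.FinPath := ⟨v, [], v, rfl⟩

variable (G) in
/-- The path of length `1` given by the edge `e`. -/
abbrev edge (e : E) : G.FinPath := ⟨G.s e, [e], G.r e, rfl, rfl⟩

/-- Concatenation of paths. -/
abbrev comp (p q : G.FinPath) (h : p.tgt = q.src) : G.FinPath :=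
  ⟨p.src, p.edges ++ q.edges, q.tgt, (G.isPath_append).2 ⟨p.tgt, p.isPath, h ▸ q.isPath⟩⟩

@[simp] theorem src_comp (p q : G.FinPath) (h) : (p.comp q h).src = p.src := rfl
@[simp] theorem tgt_comp (p q : G.FinPath) (h) : (p.comp q h).tgt = q.tgt := rfl
@[simp] theorem edges_comp (p q : G.FinPath) (h) : (p.comp q h).edges = p.edges ++ q.edges := rfl
@[simp] theorem length_comp (p q : G.FinPath) (h) : (p.comp q h).length = p.length + q.length :=
  List.length_append
@[simp] theorem src_edge (e : E) : (edge G e).src = G.s e := rfl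
@[simp] theorem tgt_edge (e : E) : (edge G e).tgt = G.r e := rfl
@[simp] theorem length_edge (e : E) : (edge G e).length = 1 := rfl
@[simp] theorem src_vertex (v : V) : (vertex G v).src = v := rfl
@[simp] theorem tgt_vertex (v : V) : (vertex G v).tgt = v := rfl
@[simp] theorem length_vertex (v : V) : (vertex G v).length = 0 := rfl

theorem comp_assoc (p q t : G.FinPath) (h) (h') :
    (p.comp q h).comp t h' = p.comp (q.comp t h') h :=
  ext' rfl (List.append_assoc ..)

theorem eq_vertex {p : G.FinPath} (h : p.edges = []) : p = vertex G p.tgt := by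
  have := p.isPath
  rw [h] at this
  exact ext' this h

theorem comp_of_nil {p q : G.FinPath} (h) (hq : q.edges = []) : p.comp q h = p :=
  ext' rfl (by simp [hq])

end FinPath

/-- The sequence of edges that starts with the list `l` and goes on with the sequence `x`. -/
def prepend : List E → (ℕ → E) → ℕ → E
  | [], x, n => x n
  | e :: _, _, 0 => e
  | _ :: l, x, n + 1 => prepend l x n

theorem prepend_spec {v w : V} {l : List E} {x : ℕ → E} (hl : G.IsPath v l w) (hw : w = G.s (x 0))
    (hx : ∀ i, G.r (x i) = G.s (x (i + 1))) :
    (∀ i, G.r (prepend l x i) = G.s (prepend l x (i + 1))) ∧ v = G.s (prepend l x 0) := by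
  induction l generalizing v with
  | nil => exact ⟨hx, hl.trans hw⟩
  | cons e l ih =>
    obtain ⟨h1, h2⟩ := ih hl.2
    refine ⟨fun i => ?_, hl.1.symm⟩
    cases i with
    | zero => exact h2
    | succ i => exact h1 i

/-- The set `X_E`: the finite paths that end in a sink or in an infinite emitter, and the infinite
paths. -/
inductive BoundaryPath where
  | fin (p : G.FinPath) (hp : G.IsSink p.tgt ∨ G.IsInfiniteEmitter p.tgt) : BoundaryPath
  | inf (x : ℕ → E) (hx : ∀ i, G.r (x i) = G.s (x (i + 1))) : BoundaryPath

namespace BoundaryPath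

variable {G}

/-- The vertex at which a path starts. -/
def src : G.BoundaryPath → V
  | fin p _ => p.src
  | inf x _ => G.s (x 0)

/-- The path `αx`, for a finite path `α` and `x ∈ X_E` with `r(α) = s(x)`. -/
def concat (α : G.FinPath) : (x : G.BoundaryPath) → α.tgt = x.src → G.BoundaryPath
  | fin p hp, h => fin (α.comp p h) hp
  | inf x hx, h => inf (prepend α.edges x) (G.prepend_spec α.isPath h hx).1

/-- Auxiliary: the `n`-th edge of a path, if there is one. -/
def seq : G.BoundaryPath → ℕ → Option E
  | fin p _ => fun n => p.edges[n]?
  | inf x _ => fun n => some (x n)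

theorem ext_seq {x y : G.BoundaryPath} (h : x.src = y.src) (h' : x.seq = y.seq) : x = y := by
  cases x with
  | fin p hp =>
    cases y with
    | fin q hq =>
      have : p = q := FinPath.ext' h (List.ext_getElem? fun n => congrFun h' n)
      subst this
      rfl
    | inf y hy =>
      have := congrFun h' p.edges.length
      simp [seq] at this
  | inf x hx =>
    cases y with
    | fin q hq =>
      have := congrFun h' q.edges.length
      simp [seq] at this
    | inf y hy =>
      have : x = y := funext fun n => Option.some.inj (congrFun h' n)
      subst this
      rfl

/-- Auxiliary: a list followed by a partial sequence. -/
def app : List E → (ℕ → Option E) → ℕ → Option E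
  | [], σ, n => σ n
  | e :: _, _, 0 => some e
  | _ :: l, σ, n + 1 => app l σ n

theorem app_append (l l' : List E) (σ : ℕ → Option E) : app (l ++ l') σ = app l (app l' σ) := by
  induction l with
  | nil => rfl
  | cons e l ih =>
    funext n
    cases n with
    | zero => rfl
    | succ n => exact congrFun ih n

theorem app_eq_app {l m : List E} {σ τ : ℕ → Option E} (h : app l σ = app m τ)
    (hle : m.length ≤ l.length) : ∃ l', l = m ++ l' ∧ τ = app l' σ := by
  induction m generalizing l with
  | nil => exact ⟨l, rfl, h.symm⟩
  | cons e m ih =>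
    cases l with
    | nil => simp at hle
    | cons f l =>
      have h0 : some f = some e := congrFun h 0
      obtain ⟨l', h1, h2⟩ := ih (l := l) (funext fun n => congrFun h (n + 1)) (by simpa using hle)
      exact ⟨l', by rw [Option.some.inj h0, h1]; rfl, h2⟩

@[simp] theorem src_concat (α : G.FinPath) (x : G.BoundaryPath) (h) : (concat α x h).src = α.src := by
  cases x with
  | fin p hp => rfl
  | inf x hx => exact (G.prepend_spec α.isPath h hx).2.symm

theorem seq_concat (α : G.FinPath) (x : G.BoundaryPath) (h) :
    (concat α x h).seq = app α.edges x.seq := by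
  cases x with
  | fin p hp =>
    show (fun n => (α.edges ++ p.edges)[n]?) = app α.edges (fun n => p.edges[n]?)
    generalize α.edges = l
    induction l with
    | nil => rfl
    | cons e l ih =>
      funext n
      cases n with
      | zero => rfl
      | succ n => exact congrFun ih n
  | inf x hx =>
    show (fun n => some (prepend α.edges x n)) = app α.edges (fun n => some (x n))
    generalize α.edges = l
    induction l with
    | nil => rfl
    | cons e l ih =>
      funext n
      cases n with
      | zero => rfl
      | succ n => exact congrFun ih n

theorem concat_comp (α β : G.FinPath) (x : G.BoundaryPath) (h) (h') :
    concat (α.comp β h) x h' = concat α (concat β x h') (h.trans (src_concat _ _ _).symm) :=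
  ext_seq (by simp) (by rw [seq_concat, seq_concat, seq_concat, FinPath.edges_comp, app_append])

theorem concat_of_nil {α : G.FinPath} (hα : α.edges = []) (x : G.BoundaryPath) (h) :
    concat α x h = x := by
  have : α.src = α.tgt := by
    have := α.isPath
    rwa [hα] at this
  exact ext_seq (by rw [src_concat, this, h]) (by rw [seq_concat, hα]; rfl)

theorem concat_eq_concat {α γ : G.FinPath} {x y : G.BoundaryPath} {hα} {hγ}
    (h : concat α x hα = concat γ y hγ) (hle : γ.length ≤ α.length) :
    ∃ (μ : G.FinPath) (h1 : γ.tgt = μ.src) (h2 : μ.tgt = x.src),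
      α = γ.comp μ h1 ∧ y = concat μ x h2 := by
  have hs := congrArg seq h
  rw [seq_concat, seq_concat] at hs
  obtain ⟨l, h1, h2⟩ := app_eq_app hs hle
  have hp := α.isPath
  rw [h1, isPath_append] at hp
  obtain ⟨u, hu, hu'⟩ := hp
  have hsrc : α.src = γ.src := by
    have := congrArg src h
    simpa using this
  obtain rfl : γ.tgt = u := γ.isPath.tgt_unique (hsrc ▸ hu)
  refine ⟨⟨γ.tgt, l, α.tgt, hu'⟩, rfl, hα, FinPath.ext' hsrc h1, ext_seq ?_ ?_⟩
  · exact hγ.symm.trans (src_concat ⟨γ.tgt, l, α.tgt, hu'⟩ x hα).symm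
  · rw [seq_concat, h2]

theorem concat_injective {α : G.FinPath} {x y : G.BoundaryPath} {hx} {hy}
    (h : concat α x hx = concat α y hy) : x = y := by
  obtain ⟨μ, h1, h2, h3, h4⟩ := concat_eq_concat h le_rfl
  have : μ.edges = [] := by simpa using congrArg FinPath.edges h3
  rw [h4, concat_of_nil this]

/-- A path in `X_E` is trivial or begins with an edge. -/
theorem cases_edge (x : G.BoundaryPath) :
    (∃ h, x = fin (FinPath.vertex G x.src) h) ∨
      ∃ (e : E) (y : G.BoundaryPath) (h : G.r e = y.src), x = concat (FinPath.edge G e) y h := by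
  cases x with
  | fin p hp =>
    obtain ⟨v, l, w, h⟩ := p
    cases l with
    | nil =>
      obtain rfl : v = w := h
      exact Or.inl ⟨hp, rfl⟩
    | cons e l =>
      obtain ⟨rfl, h⟩ := h
      exact Or.inr ⟨e, fin ⟨G.r e, l, w, h⟩ hp, rfl, rfl⟩
  | inf x hx =>
    let y : G.BoundaryPath := inf (fun n => x (n + 1)) (fun i => hx (i + 1))
    have hy : (FinPath.edge G (x 0)).tgt = y.src := hx 0
    refine Or.inr ⟨x 0, y, hy, ext_seq (src_concat _ y hy).symm
      (Eq.trans (funext fun n => ?_) (seq_concat _ y hy).symm)⟩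
    cases n <;> rfl

end BoundaryPath

open BoundaryPath

/-- The graph groupoid `𝒢_E`, as the set of all triples `(αx, |α| - |β|, βx)` with finite paths
`α`, `β` and `x ∈ X_E` such that `r(α) = s(x) = r(β)`. The arrow `(x, k, y)` has range `x` and
source `y`. -/
@[ext] structure Groupoid where
  rng : G.BoundaryPath
  deg : ℤ
  src : G.BoundaryPath
  mem : ∃ (α β : G.FinPath) (x : G.BoundaryPath) (hα : α.tgt = x.src) (hβ : β.tgt = x.src),
    rng = concat α x hα ∧ deg = (α.length : ℤ) - β.length ∧ src = concat β x hβ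

namespace Groupoid

variable {G}

/-- The arrow `(αx, |α| - |β|, βx)`. -/
def arr (α β : G.FinPath) (x : G.BoundaryPath) (hα : α.tgt = x.src) (hβ : β.tgt = x.src) :
    G.Groupoid :=
  ⟨concat α x hα, (α.length : ℤ) - β.length, concat β x hβ, α, β, x, hα, hβ, rfl, rfl, rfl⟩

theorem exists_arr (g : G.Groupoid) : ∃ α β x hα hβ, g = arr α β x hα hβ := by
  obtain ⟨a, k, b, α, β, x, hα, hβ, rfl, rfl, rfl⟩ := g
  exact ⟨α, β, x, hα, hβ, rfl⟩

theorem arr_comp (α β μ : G.FinPath) (x : G.BoundaryPath) (hα hβ) (hx : μ.tgt = x.src) :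
    arr (α.comp μ hα) (β.comp μ hβ) x hx hx =
      arr α β (concat μ x hx) (hα.trans (src_concat _ _ _).symm)
        (hβ.trans (src_concat _ _ _).symm) := by
  ext1
  · exact concat_comp ..
  · simp [arr]
  · exact concat_comp ..

theorem arr_eq_arr {α β γ δ : G.FinPath} {x y : G.BoundaryPath} {hα hβ hγ hδ}
    (h : arr α β x hα hβ = arr γ δ y hγ hδ) (hle : γ.length ≤ α.length) :
    ∃ (μ : G.FinPath) (h1 : γ.tgt = μ.src) (h1' : δ.tgt = μ.src) (h2 : μ.tgt = x.src),
      α = γ.comp μ h1 ∧ β = δ.comp μ h1' ∧ y = concat μ x h2 := by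
  obtain ⟨μ, h1, h2, rfl, rfl⟩ := concat_eq_concat (congrArg rng h) hle
  have hd : ((γ.comp μ h1).length : ℤ) - β.length = γ.length - δ.length := congrArg deg h
  have hl : β.length = δ.length + μ.length := by
    rw [FinPath.length_comp] at hd
    omega
  obtain ⟨ν, h3, h4, rfl, h5⟩ := concat_eq_concat (congrArg src h) (by omega)
  have hν : ν.length = μ.length := by rw [FinPath.length_comp] at hl; omega
  obtain ⟨κ, h6, h7, h8, -⟩ := concat_eq_concat h5 hν.le
  have hκ : κ.edges = [] := by
    have := congrArg FinPath.length h8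
    rw [FinPath.length_comp] at this
    exact List.length_eq_zero_iff.1 (show κ.length = 0 by omega)
  obtain rfl : μ = ν := h8.trans (FinPath.comp_of_nil h6 hκ)
  exact ⟨μ, h1, h3, h2, rfl, rfl, rfl⟩

theorem exists_composable {g h : G.Groupoid} (hc : g.src = h.rng) :
    ∃ α β δ x hα hβ hδ, g = arr α β x hα hβ ∧ h = arr β δ x hβ hδ := by
  obtain ⟨α, β, x, hα, hβ, rfl⟩ := g.exists_arr
  obtain ⟨γ, δ, y, hγ, hδ, rfl⟩ := h.exists_arr
  have hc : concat β x hβ = concat γ y hγ := hc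
  rcases le_total γ.length β.length with hle | hle
  · obtain ⟨μ, h1, h2, rfl, rfl⟩ := concat_eq_concat hc hle
    have h3 : δ.tgt = μ.src := hδ.trans (src_concat _ _ _)
    exact ⟨α, γ.comp μ h1, δ.comp μ h3, x, hα, h2, h2, rfl, (arr_comp ..).symm⟩
  · obtain ⟨μ, h1, h2, rfl, rfl⟩ := concat_eq_concat hc.symm hle
    have h3 : α.tgt = μ.src := hα.trans (src_concat _ _ _)
    exact ⟨α.comp μ h3, β.comp μ h1, δ, y, h2, h2, hδ, (arr_comp ..).symm, rfl⟩

/-- The composition `(x, k, y) (y, l, z) = (x, k + l, z)`. -/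
def comp (g h : G.Groupoid) (hc : g.src = h.rng) : G.Groupoid where
  rng := g.rng
  deg := g.deg + h.deg
  src := h.src
  mem := by
    obtain ⟨α, β, δ, x, hα, hβ, hδ, rfl, rfl⟩ := exists_composable hc
    exact ⟨α, δ, x, hα, hδ, rfl, by simp [arr], rfl⟩

/-- The inverse `(x, k, y)⁻¹ = (y, -k, x)`. -/
def inv (g : G.Groupoid) : G.Groupoid where
  rng := g.src
  deg := -g.deg
  src := g.rng
  mem := by
    obtain ⟨α, β, x, hα, hβ, rfl⟩ := g.exists_arr
    exact ⟨β, α, x, hβ, hα, rfl, by simp [arr], rfl⟩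

/-- The unit `(x, 0, x)`. -/
def unit (x : G.BoundaryPath) : G.Groupoid where
  rng := x
  deg := 0
  src := x
  mem := by
    have h : (FinPath.vertex G x.src).edges = [] := rfl
    exact ⟨FinPath.vertex G x.src, FinPath.vertex G x.src, x, rfl, rfl,
      (concat_of_nil h _ _).symm, by simp, (concat_of_nil h _ _).symm⟩

theorem arr_comp_arr (α β δ : G.FinPath) (x : G.BoundaryPath) (hα hβ hδ) :
    (arr α β x hα hβ).comp (arr β δ x hβ hδ) rfl = arr α δ x hα hδ := by
  ext1
  · rfl
  · simp [comp, arr]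
  · rfl

theorem unit_concat (α : G.FinPath) (x : G.BoundaryPath) (hα) :
    unit (concat α x hα) = arr α α x hα hα := by
  ext1
  · rfl
  · simp [unit, arr]
  · rfl

/-- The set `Z(α, β)` of all arrows `(αx, |α| - |β|, βx)`. -/
def Z (α β : G.FinPath) : Set G.Groupoid :=
  {g | ∃ (x : G.BoundaryPath) (hα : α.tgt = x.src) (hβ : β.tgt = x.src), g = arr α β x hα hβ}

/-- The set `Z(α, β, F) = Z(α, β) \ ⋃_{e ∈ F} Z(αe, βe)`. -/
def ZF (α β : G.FinPath) (F : Finset E) : Set G.Groupoid :=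
  Z α β \ {g | ∃ e ∈ F, ∃ (hα : α.tgt = G.s e) (hβ : β.tgt = G.s e),
    g ∈ Z (α.comp (FinPath.edge G e) hα) (β.comp (FinPath.edge G e) hβ)}

variable (G) in
/-- The collection of all `Z(α, β, F)`, where `α` and `β` are finite paths with `r(α) = r(β)` and
`F` is a finite set of edges starting at `r(α)`. -/
def basicSets : Set (Set G.Groupoid) :=
  {U | ∃ (α β : G.FinPath) (F : Finset E),
    α.tgt = β.tgt ∧ (∀ e ∈ F, G.s e = α.tgt) ∧ U = ZF α β F}

/-- The topology of `𝒢_E`, given by the base of the sets `Z(α, β, F)`. -/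
instance : TopologicalSpace G.Groupoid := TopologicalSpace.generateFrom (basicSets G)

/-- The unit space `𝒢_E^(0)`, identified with `X_E`, has the subspace topology of `𝒢_E`. -/
instance : TopologicalSpace G.BoundaryPath := TopologicalSpace.induced unit inferInstance

/-- An open bisection: an open set on which source and range are homeomorphisms onto open subsets of
the unit space. -/
def IsOpenBisection (U : Set G.Groupoid) : Prop :=
  IsOpen U ∧ IsOpenEmbedding (U.domRestrict (src : G.Groupoid → G.BoundaryPath)) ∧
    IsOpenEmbedding (U.domRestrict (rng : G.Groupoid → G.BoundaryPath))

def IsCompactOpenBisection (U : Set G.Groupoid) : Prop := IsCompact U ∧ IsOpenBisection U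

/-- The product `UV = {gh | g ∈ U, h ∈ V, s(g) = r(h)}` of two sets of arrows. -/
def setMul (U V : Set G.Groupoid) : Set G.Groupoid :=
  {γ | ∃ g ∈ U, ∃ h ∈ V, ∃ hc : g.src = h.rng, g.comp h hc = γ}

theorem arr_mem_Z (α β : G.FinPath) (x : G.BoundaryPath) (hα hβ) : arr α β x hα hβ ∈ Z α β :=
  ⟨x, hα, hβ, rfl⟩

theorem Z_comp_subset (α β μ : G.FinPath) (hα hβ) : Z (α.comp μ hα) (β.comp μ hβ) ⊆ Z α β := by
  rintro _ ⟨x, h, h', rfl⟩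
  rw [arr_comp]
  exact arr_mem_Z ..

theorem ZF_empty (α β : G.FinPath) : ZF α β ∅ = Z α β := by simp [ZF]

/-- Two arrows of `Z(αμ, βμ)`, with `μ` of positive length, lie in the same sets `Z(αe, βe)`. -/
theorem Z_comp_subset_ZF {α β μ : G.FinPath} {hα hβ} (hμ : μ.edges ≠ []) {F : Finset E}
    {g : G.Groupoid} (hg : g ∈ Z (α.comp μ hα) (β.comp μ hβ)) (hgF : g ∈ ZF α β F) :
    Z (α.comp μ hα) (β.comp μ hβ) ⊆ ZF α β F := by
  rintro g' hg'
  refine ⟨Z_comp_subset _ _ _ _ _ hg', ?_⟩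
  rintro ⟨e, he, hαe, hβe, hge⟩
  refine hgF.2 ⟨e, he, hαe, hβe, ?_⟩
  obtain ⟨x, h1, h2, rfl⟩ := hg'
  obtain ⟨y, h3, h4, h5⟩ := hge
  have hlen : 1 ≤ μ.length := List.length_pos_iff.2 hμ
  obtain ⟨ν, h6, h7, h8, h9, h10, -⟩ := arr_eq_arr h5 (by simpa using hlen)
  rw [h9, h10] at hg
  exact Z_comp_subset _ _ _ _ _ hg

theorem arr_mem_ZF_iff {α β : G.FinPath} {F : Finset E} {x : G.BoundaryPath} {hα hβ} :
    arr α β x hα hβ ∈ ZF α β F ↔ ∀ e ∈ F, ∀ y h, x ≠ concat (FinPath.edge G e) y h := by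
  constructor
  · rintro ⟨-, hn⟩ e he y h rfl
    have h1 : α.tgt = (FinPath.edge G e).src := hα.trans (src_concat _ _ _)
    have h2 : β.tgt = (FinPath.edge G e).src := hβ.trans (src_concat _ _ _)
    exact hn ⟨e, he, h1, h2, y, h, h, (arr_comp ..).symm⟩
  · rintro hn
    refine ⟨arr_mem_Z .., ?_⟩
    rintro ⟨e, he, h1, h2, y, h3, h4, h5⟩
    rw [arr_comp] at h5
    exact hn e he y h3 (concat_injective (congrArg rng h5))

/-- Around `(αx, |α| - |β|, βx)` the sets `Z(αμ, βμ, F)`, with `x = μy`, form a base of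
neighbourhoods. -/
theorem exists_ZF_subset {O : Set G.Groupoid} (hO : IsOpen O) (α β : G.FinPath)
    (x : G.BoundaryPath) (hα : α.tgt = x.src) (hβ : β.tgt = x.src) (hg : arr α β x hα hβ ∈ O) :
    ∃ (μ : G.FinPath) (y : G.BoundaryPath) (hy : μ.tgt = y.src) (h1 : α.tgt = μ.src)
      (h2 : β.tgt = μ.src) (F : Finset E), x = concat μ y hy ∧ (∀ e ∈ F, G.s e = μ.tgt) ∧
      arr (α.comp μ h1) (β.comp μ h2) y hy hy ∈ ZF (α.comp μ h1) (β.comp μ h2) F ∧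
      ZF (α.comp μ h1) (β.comp μ h2) F ⊆ O := by
  classical
  have key (O : Set G.Groupoid) (γ δ : G.FinPath) (F : Finset E) (hF : ∀ e ∈ F, G.s e = γ.tgt)
      (α β : G.FinPath) (x : G.BoundaryPath) (hα : α.tgt = x.src) (hβ : β.tgt = x.src)
      (hg : arr α β x hα hβ ∈ ZF γ δ F) (hO : ZF γ δ F ⊆ O) :
      ∃ (μ : G.FinPath) (y : G.BoundaryPath) (hy : μ.tgt = y.src) (h1 : α.tgt = μ.src)
        (h2 : β.tgt = μ.src) (F : Finset E), x = concat μ y hy ∧ (∀ e ∈ F, G.s e = μ.tgt) ∧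
        arr (α.comp μ h1) (β.comp μ h2) y hy hy ∈ ZF (α.comp μ h1) (β.comp μ h2) F ∧
        ZF (α.comp μ h1) (β.comp μ h2) F ⊆ O := by
    have hv : (FinPath.vertex G x.src).edges = [] := rfl
    obtain ⟨z, hγ, hδ, hz⟩ := hg.1
    rcases le_total γ.length α.length with hle | hle
    · obtain ⟨μ, h1, h1', h2, rfl, rfl, rfl⟩ := arr_eq_arr hz hle
      by_cases hμ : μ.edges = []
      · refine ⟨FinPath.vertex G x.src, x, rfl, hα, hβ, F, (concat_of_nil hv _ _).symm, ?_, ?_, ?_⟩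
        · intro e he
          rw [hF e he, h1, FinPath.eq_vertex hμ]
          exact h2
        · simp only [FinPath.comp_of_nil _ hv, FinPath.comp_of_nil _ hμ]
          simpa only [FinPath.comp_of_nil _ hμ] using hg
        · simpa only [FinPath.comp_of_nil _ hv, FinPath.comp_of_nil _ hμ] using hO
      · refine ⟨FinPath.vertex G x.src, x, rfl, hα, hβ, ∅, (concat_of_nil hv _ _).symm, by simp,
          ?_, ?_⟩
        · simp only [FinPath.comp_of_nil _ hv, ZF_empty]
          exact arr_mem_Z ..
        · simp only [FinPath.comp_of_nil _ hv, ZF_empty]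
          exact (Z_comp_subset_ZF hμ (arr_mem_Z _ _ _ _ _) hg).trans hO
    · obtain ⟨μ, h1, h1', h2, rfl, rfl, rfl⟩ := arr_eq_arr hz.symm hle
      refine ⟨μ, z, h2, h1, h1', F, rfl, hF, ?_, hO⟩
      rwa [arr_comp]
  induction hO generalizing α β x with
  | basic U hU =>
    obtain ⟨γ, δ, F, -, hF, rfl⟩ := hU
    exact key _ γ δ F hF α β x hα hβ hg Subset.rfl
  | univ =>
    have hv : (FinPath.vertex G x.src).edges = [] := rfl
    refine ⟨FinPath.vertex G x.src, x, rfl, hα, hβ, ∅, (concat_of_nil hv _ _).symm, by simp, ?_,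
      subset_univ _⟩
    rw [ZF_empty]
    exact arr_mem_Z ..
  | inter A B _ _ ihA ihB =>
    obtain ⟨μ, y, hy, h1, h2, F, rfl, hF, hm, hs⟩ := ihA α β x hα hβ hg.1
    have hgB := hg.2
    rw [← arr_comp α β μ y h1 h2 hy] at hgB
    obtain ⟨ν, z, hz, h3, h4, F', rfl, hF', hm', hs'⟩ := ihB (α.comp μ h1) (β.comp μ h2) y hy hy hgB
    rw [← arr_comp (α.comp μ h1) (β.comp μ h2) ν z h3 h4 hz] at hm
    by_cases hν : ν.edges = []
    · simp only [FinPath.comp_of_nil _ hν] at hm hm' hs'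
      have hνt : ν.tgt = μ.tgt := by
        rw [h3, FinPath.eq_vertex hν]
      refine ⟨μ, z, hνt.symm.trans hz, h1, h2, F ∪ F', by simp only [concat_of_nil hν], ?_, ?_, ?_⟩
      · intro e he
        rcases Finset.mem_union.1 he with he | he
        · exact hF e he
        · exact (hF' e he).trans hνt
      · refine ⟨hm.1, ?_⟩
        rintro ⟨e, he, h⟩
        rcases Finset.mem_union.1 he with he | he
        · exact hm.2 ⟨e, he, h⟩
        · exact hm'.2 ⟨e, he, h⟩
      · rintro g ⟨hg1, hg2⟩
        refine ⟨hs ⟨hg1, ?_⟩, hs' ⟨hg1, ?_⟩⟩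
        · rintro ⟨e, he, h⟩
          exact hg2 ⟨e, Finset.mem_union_left _ he, h⟩
        · rintro ⟨e, he, h⟩
          exact hg2 ⟨e, Finset.mem_union_right _ he, h⟩
    · have h5 := Z_comp_subset_ZF hν (arr_mem_Z _ _ _ _ _) hm
      have h6 : μ.tgt = ν.src := h3
      have e1 : (α.comp μ h1).comp ν h3 = α.comp (μ.comp ν h6) h1 := FinPath.comp_assoc ..
      have e2 : (β.comp μ h2).comp ν h4 = β.comp (μ.comp ν h6) h2 := FinPath.comp_assoc ..
      refine ⟨μ.comp ν h6, z, hz, h1, h2, F', (concat_comp ..).symm, hF', ?_, ?_⟩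
      · simpa only [e1, e2] using hm'
      · simp only [e1, e2] at hs' h5
        exact fun g hg' => ⟨hs (h5 hg'.1), hs' hg'⟩
  | sUnion S _ ih =>
    obtain ⟨U, hU, hgU⟩ := hg
    obtain ⟨μ, y, hy, h1, h2, F, h3, h4, h5, h6⟩ := ih U hU α β x hα hβ hgU
    exact ⟨μ, y, hy, h1, h2, F, h3, h4, h5, h6.trans (subset_sUnion_of_mem hU)⟩

theorem isOpen_ZF {α β : G.FinPath} {F : Finset E} (h : α.tgt = β.tgt)
    (hF : ∀ e ∈ F, G.s e = α.tgt) : IsOpen (ZF α β F) :=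
  TopologicalSpace.isOpen_generateFrom_of_mem ⟨α, β, F, h, hF, rfl⟩

theorem isOpen_Z (α β : G.FinPath) : IsOpen (Z α β) := by
  by_cases h : α.tgt = β.tgt
  · rw [← ZF_empty]
    exact isOpen_ZF h (by simp)
  · convert isOpen_empty
    ext g
    simp only [Z, mem_ofPred_eq, mem_empty_iff_false, iff_false]
    rintro ⟨x, hα, hβ, -⟩
    exact h (hα.trans hβ.symm)

theorem continuous_src : Continuous (src : G.Groupoid → G.BoundaryPath) := by
  refine continuous_induced_rng.2 (continuous_def.2 fun O hO => isOpen_iff_forall_mem_open.2 ?_)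
  intro g hg
  obtain ⟨α, β, x, hα, hβ, rfl⟩ := g.exists_arr
  have hg : unit (concat β x hβ) ∈ O := hg
  rw [unit_concat] at hg
  obtain ⟨μ, y, hy, h1, h2, F, rfl, hF, h4, h5⟩ := exists_ZF_subset hO _ _ _ _ _ hg
  have h3 : α.tgt = μ.src := hα.trans (src_concat _ _ _)
  refine ⟨ZF (α.comp μ h3) (β.comp μ h1) F, ?_, isOpen_ZF rfl hF, ?_⟩
  · intro g' hg'
    obtain ⟨z, hz, hz', rfl⟩ := hg'.1
    show unit (concat _ z _) ∈ O
    rw [unit_concat]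
    exact h5 (arr_mem_ZF_iff.2 (arr_mem_ZF_iff.1 hg'))
  · rw [← arr_comp α β μ y h3 h1 hy]
    exact arr_mem_ZF_iff.2 (arr_mem_ZF_iff.1 h4)

theorem inv_inv (g : G.Groupoid) : g.inv.inv = g := by
  ext1
  · rfl
  · simp [inv]
  · rfl

theorem inv_arr (α β : G.FinPath) (x : G.BoundaryPath) (hα hβ) :
    (arr α β x hα hβ).inv = arr β α x hβ hα := by
  ext1
  · rfl
  · simp [inv, arr]
  · rfl

theorem inv_mem_Z {α β : G.FinPath} {g : G.Groupoid} : g.inv ∈ Z α β ↔ g ∈ Z β α := by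
  constructor
  · rintro ⟨x, hα, hβ, h⟩
    exact ⟨x, hβ, hα, by rw [← inv_inv g, h, inv_arr]⟩
  · rintro ⟨x, hα, hβ, rfl⟩
    exact ⟨x, hβ, hα, inv_arr ..⟩

theorem continuous_inv : Continuous (inv : G.Groupoid → G.Groupoid) := by
  refine continuous_generateFrom_iff.2 ?_
  rintro _ ⟨α, β, F, h, hF, rfl⟩
  convert isOpen_ZF h.symm (fun e he => (hF e he).trans h) using 1
  ext g
  simp only [ZF, mem_preimage, Set.mem_sdiff, mem_ofPred_eq, inv_mem_Z]
  refine and_congr_right fun _ => not_congr (exists_congr fun e => and_congr_right fun _ => ?_)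
  exact ⟨fun ⟨a, b, c⟩ => ⟨b, a, c⟩, fun ⟨a, b, c⟩ => ⟨b, a, c⟩⟩

theorem continuous_rng : Continuous (rng : G.Groupoid → G.BoundaryPath) :=
  continuous_src.comp continuous_inv

theorem continuous_unit : Continuous (unit : G.BoundaryPath → G.Groupoid) :=
  continuous_induced_dom

theorem isOpenMap_src : IsOpenMap (src : G.Groupoid → G.BoundaryPath) := by
  intro O hO
  refine isOpen_iff_forall_mem_open.2 ?_
  rintro _ ⟨g, hg, rfl⟩
  obtain ⟨α, β, x, hα, hβ, rfl⟩ := g.exists_arr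
  obtain ⟨μ, y, hy, h1, h2, F, rfl, hF, h4, h5⟩ := exists_ZF_subset hO _ _ _ _ _ hg
  refine ⟨unit ⁻¹' ZF (β.comp μ h2) (β.comp μ h2) F, ?_,
    (isOpen_ZF (α := β.comp μ h2) (β := β.comp μ h2) rfl hF).preimage continuous_unit, ?_⟩
  · intro z hz
    have hz : unit z ∈ ZF (β.comp μ h2) (β.comp μ h2) F := hz
    obtain ⟨w, hw, hw', h⟩ := hz.1
    obtain rfl : z = concat _ w hw := congrArg rng h
    rw [h] at hz
    exact ⟨arr (α.comp μ h1) (β.comp μ h2) w hw hw,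
      h5 (arr_mem_ZF_iff.2 (arr_mem_ZF_iff.1 hz)), rfl⟩
  · show unit (concat β (concat μ y hy) hβ) ∈ ZF (β.comp μ h2) (β.comp μ h2) F
    rw [unit_concat, ← arr_comp β β μ y h2 h2 hy]
    exact arr_mem_ZF_iff.2 (arr_mem_ZF_iff.1 h4)

theorem isOpenMap_inv : IsOpenMap (inv : G.Groupoid → G.Groupoid) := by
  intro O hO
  rw [image_eq_preimage_of_inverse inv_inv inv_inv]
  exact hO.preimage continuous_inv

theorem isOpenMap_rng : IsOpenMap (rng : G.Groupoid → G.BoundaryPath) :=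
  isOpenMap_src.comp isOpenMap_inv

theorem isOpenBisection_iff {U : Set G.Groupoid} :
    IsOpenBisection U ↔ IsOpen U ∧ InjOn src U ∧ InjOn rng U := by
  constructor
  · rintro ⟨h, h1, h2⟩
    exact ⟨h, injOn_iff_injective.2 h1.injective, injOn_iff_injective.2 h2.injective⟩
  · rintro ⟨h, h1, h2⟩
    exact ⟨h, .of_continuous_injective_isOpenMap (continuous_src.comp continuous_subtype_val)
        (injOn_iff_injective.1 h1) (isOpenMap_src.domRestrict h),
      .of_continuous_injective_isOpenMap (continuous_rng.comp continuous_subtype_val)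
        (injOn_iff_injective.1 h2) (isOpenMap_rng.domRestrict h)⟩

theorem arr_injective {α β : G.FinPath} {x y : G.BoundaryPath} {h1 h2 h3 h4}
    (h : arr α β x h1 h2 = arr α β y h3 h4) : x = y :=
  concat_injective (congrArg rng h)

theorem isOpen_transport {V : Set G.Groupoid} (hV : IsOpen V) (α β γ δ : G.FinPath) :
    IsOpen {g | ∃ x hα hβ hγ hδ, g = arr α β x hα hβ ∧ arr γ δ x hγ hδ ∈ V} := by
  refine isOpen_iff_forall_mem_open.2 ?_
  rintro _ ⟨x, hα, hβ, hγ, hδ, rfl, hx⟩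
  obtain ⟨μ, y, hy, h1, h2, F, rfl, hF, h4, h5⟩ := exists_ZF_subset hV _ _ _ _ _ hx
  have h6 : α.tgt = μ.src := hα.trans (src_concat _ _ _)
  have h7 : β.tgt = μ.src := hβ.trans (src_concat _ _ _)
  refine ⟨ZF (α.comp μ h6) (β.comp μ h7) F, ?_, isOpen_ZF rfl hF, ?_⟩
  · intro g hg
    obtain ⟨z, hz, hz', rfl⟩ := hg.1
    have hs := (src_concat μ z hz).symm
    refine ⟨concat μ z hz, h6.trans hs, h7.trans hs, h1.trans hs, h2.trans hs, arr_comp .., ?_⟩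
    rw [← arr_comp γ δ μ z h1 h2 hz]
    exact h5 (arr_mem_ZF_iff.2 (arr_mem_ZF_iff.1 hg))
  · rw [← arr_comp α β μ y h6 h7 hy]
    exact arr_mem_ZF_iff.2 (arr_mem_ZF_iff.1 h4)

/-- The multiplication of the groupoid is continuous. -/
theorem exists_open_comp {g h : G.Groupoid} (hc : g.src = h.rng) {O : Set G.Groupoid}
    (hO : IsOpen O) (hgh : g.comp h hc ∈ O) :
    ∃ A B : Set G.Groupoid, IsOpen A ∧ IsOpen B ∧ g ∈ A ∧ h ∈ B ∧
      ∀ g' ∈ A, ∀ h' ∈ B, ∀ hc' : g'.src = h'.rng, g'.comp h' hc' ∈ O := by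
  obtain ⟨α, β, δ, x, hα, hβ, hδ, rfl, rfl⟩ := exists_composable hc
  rw [arr_comp_arr] at hgh
  refine ⟨_, Z β δ, isOpen_transport hO α β α δ, isOpen_Z β δ,
    ⟨x, hα, hβ, hα, hδ, rfl, hgh⟩, arr_mem_Z .., ?_⟩
  rintro _ ⟨y, h1, h2, h3, h4, rfl, h5⟩ _ ⟨z, h6, h7, rfl⟩ hc'
  obtain rfl : y = z := concat_injective hc'
  rwa [arr_comp_arr]

theorem isOpen_setMul {U V : Set G.Groupoid} (hU : IsOpen U) (hV : IsOpen V) :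
    IsOpen (setMul U V) := by
  refine isOpen_iff_forall_mem_open.2 ?_
  rintro _ ⟨g, hg, h, hh, hc, rfl⟩
  obtain ⟨α, β, δ, x, hα, hβ, hδ, rfl, rfl⟩ := exists_composable hc
  rw [arr_comp_arr]
  refine ⟨_, ?_, (isOpen_transport hU α δ α β).inter (isOpen_transport hV α δ β δ),
    ⟨x, hα, hδ, hα, hβ, rfl, hg⟩, ⟨x, hα, hδ, hβ, hδ, rfl, hh⟩⟩
  rintro _ ⟨⟨y, h1, h2, h3, h4, rfl, h5⟩, ⟨z, h6, h7, h8, h9, h10, h11⟩⟩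
  obtain rfl := arr_injective h10
  exact ⟨_, h5, _, h11, rfl, arr_comp_arr ..⟩

/-- The set of all paths of `X_E` that extend `μ`. -/
def cyl (μ : G.FinPath) : Set G.BoundaryPath := unit ⁻¹' Z μ μ

theorem mem_cyl {μ : G.FinPath} {x : G.BoundaryPath} : x ∈ cyl μ ↔ ∃ y h, x = concat μ y h := by
  constructor
  · rintro ⟨y, h, _, h'⟩
    exact ⟨y, h, congrArg rng h'⟩
  · rintro ⟨y, h, rfl⟩
    exact ⟨y, h, h, unit_concat ..⟩

theorem mem_cyl_vertex {v : V} {x : G.BoundaryPath} : x ∈ cyl (FinPath.vertex G v) ↔ x.src = v := by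
  rw [mem_cyl]
  constructor
  · rintro ⟨y, h, rfl⟩
    exact src_concat _ _ _
  · rintro rfl
    exact ⟨x, rfl, (concat_of_nil rfl _ _).symm⟩

theorem concat_mem_cyl {α μ : G.FinPath} {x : G.BoundaryPath} (h : α.tgt = μ.src) (hx) :
    concat α x hx ∈ cyl (α.comp μ h) ↔ x ∈ cyl μ := by
  rw [mem_cyl, mem_cyl]
  constructor
  · rintro ⟨y, h1, h2⟩
    rw [concat_comp] at h2
    exact ⟨y, h1, concat_injective h2⟩
  · rintro ⟨y, h1, rfl⟩
    exact ⟨y, h1, (concat_comp ..).symm⟩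

theorem isOpen_cyl (μ : G.FinPath) : IsOpen (cyl μ) := (isOpen_Z μ μ).preimage continuous_unit

theorem isClosed_cyl (μ : G.FinPath) : IsClosed (cyl μ) := by
  obtain ⟨l, hl⟩ : ∃ l, μ.edges = l := ⟨_, rfl⟩
  induction l using List.reverseRecOn generalizing μ with
  | nil =>
    rw [FinPath.eq_vertex hl, ← isOpen_compl_iff]
    have : (cyl (FinPath.vertex G μ.tgt))ᶜ = ⋃ v ∈ {v | v ≠ μ.tgt}, cyl (FinPath.vertex G v) := by
      ext x
      simp [mem_cyl_vertex]
    rw [this]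
    exact isOpen_biUnion fun v _ => isOpen_cyl _
  | append_singleton l e ih =>
    have hp := μ.isPath
    rw [hl, isPath_append] at hp
    obtain ⟨u, hu, rfl, hr⟩ := hp
    let q : G.FinPath := ⟨μ.src, l, G.s e, hu⟩
    have hμ : μ = q.comp (FinPath.edge G e) rfl := FinPath.ext' rfl hl
    rw [hμ]
    have h1 : IsOpen (unit ⁻¹' ZF q q {e}) :=
      (isOpen_ZF rfl (by simp [q])).preimage continuous_unit
    convert (ih q rfl).inter h1.isClosed_compl using 1
    ext x
    constructor
    · intro hx
      exact ⟨Z_comp_subset _ _ _ _ _ hx, fun h => h.2 ⟨e, by simp, rfl, rfl, hx⟩⟩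
    · rintro ⟨h2, h3⟩
      by_contra h4
      refine h3 ⟨h2, ?_⟩
      rintro ⟨f, hf, h5, h6, h7⟩
      obtain rfl := Finset.mem_singleton.1 hf
      exact h4 h7

theorem eq_of_cyl {x y : G.BoundaryPath} (h : ∀ μ : G.FinPath, x ∈ cyl μ ↔ y ∈ cyl μ) : x = y := by
  have hsrc {x y : G.BoundaryPath} (h : ∀ μ : G.FinPath, x ∈ cyl μ ↔ y ∈ cyl μ) :
      x.src = y.src := (mem_cyl_vertex.1 ((h _).1 (mem_cyl_vertex.2 rfl))).symm
  have h0 {x : G.BoundaryPath} {e : E} (hx : x ∈ cyl (FinPath.edge G e)) : x.seq 0 = some e := by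
    obtain ⟨y, h, rfl⟩ := mem_cyl.1 hx
    rw [seq_concat]
    rfl
  refine ext_seq (hsrc h) (funext fun n => ?_)
  induction n generalizing x y with
  | zero =>
    rcases x.cases_edge with ⟨hx, h1⟩ | ⟨e, x', hx, h1⟩
    · rcases y.cases_edge with ⟨hy, h2⟩ | ⟨f, y', hy, h2⟩
      · rw [h1, h2]
        rfl
      · have := h0 ((h _).2 (mem_cyl.2 ⟨y', hy, h2⟩))
        rw [this, h2, seq_concat]
        rfl
    · have := h0 ((h _).1 (mem_cyl.2 ⟨x', hx, h1⟩))
      rw [this, h1, seq_concat]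
      rfl
  | succ n ih =>
    have key {x y : G.BoundaryPath} (h : ∀ μ : G.FinPath, x ∈ cyl μ ↔ y ∈ cyl μ) {e : E}
        {x' : G.BoundaryPath} (hx : G.r e = x'.src) (h1 : x = concat (FinPath.edge G e) x' hx) :
        ∃ y' hy, y = concat (FinPath.edge G e) y' hy ∧
          ∀ μ : G.FinPath, x' ∈ cyl μ ↔ y' ∈ cyl μ := by
      obtain ⟨y', hy, h2⟩ := mem_cyl.1 ((h _).1 (mem_cyl.2 ⟨x', hx, h1⟩))
      refine ⟨y', hy, h2, fun μ => ?_⟩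
      by_cases hμ : (FinPath.edge G e).tgt = μ.src
      · rw [← concat_mem_cyl hμ hx, ← concat_mem_cyl hμ hy, ← h1, ← h2, h]
      · refine iff_of_false ?_ ?_
        · intro h'
          obtain ⟨z, hz, rfl⟩ := mem_cyl.1 h'
          exact hμ (hx.trans (src_concat _ _ _))
        · intro h'
          obtain ⟨z, hz, rfl⟩ := mem_cyl.1 h'
          exact hμ (hy.trans (src_concat _ _ _))
    rcases x.cases_edge with ⟨hx, h1⟩ | ⟨e, x', hx, h1⟩
    · rcases y.cases_edge with ⟨hy, h2⟩ | ⟨f, y', hy, h2⟩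
      · rw [h1, h2]
        rfl
      · obtain ⟨x', hx', h3, h4⟩ := key (fun μ => (h μ).symm) hy h2
        rw [h2, h3, seq_concat, seq_concat]
        exact (ih h4).symm
    · obtain ⟨y', hy', h3, h4⟩ := key h hx h1
      rw [h1, h3, seq_concat, seq_concat]
      exact ih h4

instance : T2Space G.BoundaryPath where
  t2 x y hxy := by
    have : ∃ μ : G.FinPath, ¬ (x ∈ cyl μ ↔ y ∈ cyl μ) := by
      by_contra! h
      exact hxy (eq_of_cyl h)
    obtain ⟨μ, hμ⟩ := this
    by_cases hx : x ∈ cyl μ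
    · exact ⟨cyl μ, (cyl μ)ᶜ, isOpen_cyl μ, (isClosed_cyl μ).isOpen_compl, hx,
        fun hy => hμ (iff_of_true hx hy), disjoint_compl_right⟩
    · exact ⟨(cyl μ)ᶜ, cyl μ, (isClosed_cyl μ).isOpen_compl, isOpen_cyl μ, hx,
        by_contra fun hy => hμ (iff_of_false hx hy), disjoint_compl_left⟩

theorem isCompact_setMul {U V : Set G.Groupoid} (hU : IsCompact U) (hV : IsCompact V) :
    IsCompact (setMul U V) := by
  classical
  let m : G.Groupoid × G.Groupoid → G.Groupoid :=
    fun p => if h : p.1.src = p.2.rng then p.1.comp p.2 h else p.1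
  let D : Set (G.Groupoid × G.Groupoid) := {p | p.1.src = p.2.rng}
  have hD : IsClosed D :=
    isClosed_eq (continuous_src.comp continuous_fst) (continuous_rng.comp continuous_snd)
  have hm : ContinuousOn m D := by
    intro p hp
    have hp' : p.1.src = p.2.rng := hp
    have hmp : m p = p.1.comp p.2 hp' := dif_pos hp'
    intro O hO
    obtain ⟨O', hO'O, hO', hpO'⟩ := mem_nhds_iff.1 hO
    rw [hmp] at hpO'
    obtain ⟨A, B, hA, hB, h1, h2, h3⟩ := exists_open_comp hp' hO' hpO'
    refine mem_nhdsWithin.2 ⟨A ×ˢ B, hA.prod hB, ⟨h1, h2⟩, ?_⟩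
    rintro q ⟨⟨hq1, hq2⟩, hq⟩
    have hq' : q.1.src = q.2.rng := hq
    refine hO'O ?_
    rw [show m q = q.1.comp q.2 hq' from dif_pos hq']
    exact h3 _ hq1 _ hq2 _
  have := ((hU.prod hV).inter_right hD).image_of_continuousOn (hm.mono inter_subset_right)
  convert this using 1
  ext γ
  constructor
  · rintro ⟨g, hg, h, hh, hc, rfl⟩
    exact ⟨(g, h), ⟨⟨hg, hh⟩, hc⟩, dif_pos hc⟩
  · rintro ⟨⟨g, h⟩, ⟨⟨hg, hh⟩, hc⟩, rfl⟩
    exact ⟨g, hg, h, hh, hc, (dif_pos (show g.src = h.rng from hc)).symm⟩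

theorem comp_left_cancel {g g' h h' : G.Groupoid} {hc : g.src = h.rng} {hc' : g'.src = h'.rng}
    (hg : g = g') (he : g.comp h hc = g'.comp h' hc') : h = h' := by
  subst hg
  ext1
  · exact hc.symm.trans hc'
  · have := congrArg deg he
    exact add_left_cancel this
  · have := congrArg src he
    exact this

theorem comp_right_cancel {g g' h h' : G.Groupoid} {hc : g.src = h.rng} {hc' : g'.src = h'.rng}
    (hh : h = h') (he : g.comp h hc = g'.comp h' hc') : g = g' := by
  subst hh
  ext1
  · have := congrArg rng he
    exact this
  · have := congrArg deg he
    exact add_right_cancel this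
  · exact hc.trans hc'.symm

theorem IsCompactOpenBisection.setMul {U V : Set G.Groupoid} (hU : IsCompactOpenBisection U)
    (hV : IsCompactOpenBisection V) : IsCompactOpenBisection (setMul U V) := by
  obtain ⟨hU, hU'⟩ := hU
  obtain ⟨hV, hV'⟩ := hV
  rw [isOpenBisection_iff] at hU' hV'
  refine ⟨isCompact_setMul hU hV, isOpenBisection_iff.2 ⟨isOpen_setMul hU'.1 hV'.1, ?_, ?_⟩⟩
  · rintro _ ⟨g, hg, h, hh, hc, rfl⟩ _ ⟨g', hg', h', hh', hc', rfl⟩ he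
    obtain rfl := hV'.2.1 hh hh' he
    obtain rfl := hU'.2.1 hg hg' (hc.trans hc'.symm)
    rfl
  · rintro _ ⟨g, hg, h, hh, hc, rfl⟩ _ ⟨g', hg', h', hh', hc', rfl⟩ he
    obtain rfl := hU'.2.2 hg hg' he
    obtain rfl := hV'.2.2 hh hh' (hc.symm.trans hc')
    rfl

theorem isCompact_Z {α β : G.FinPath} : IsCompact (Z α β) := by
  rw [isCompact_iff_ultrafilter_le_nhds']
  intro f hf
  -- `P μ` says that the ultrafilter lives on `Z(αμ, βμ)`
  let P : G.FinPath → Prop := fun μ => ∃ h1 h2, Z (α.comp μ h1) (β.comp μ h2) ∈ f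
  have htgt : α.tgt = β.tgt := by
    obtain ⟨g, x, hα, hβ, -⟩ := f.nonempty_of_mem hf
    exact hα.trans hβ.symm
  have hv : (FinPath.vertex G α.tgt).edges = [] := rfl
  have hP0 : P (FinPath.vertex G α.tgt) := by
    refine ⟨rfl, htgt.symm, ?_⟩
    simpa only [FinPath.comp_of_nil _ hv] using hf
  by_cases hstep : ∀ μ, P μ → ∃ (e : E) (h : μ.tgt = G.s e), P (μ.comp (FinPath.edge G e) h)
  · -- the ultrafilter converges to an arrow given by an infinite path
    choose e he he' using hstep
    let next : {μ // P μ} → {μ // P μ} := fun μ => ⟨_, he' μ.1 μ.2⟩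
    let p : ℕ → {μ // P μ} := fun n => next^[n] ⟨_, hP0⟩
    have hp (n : ℕ) : p (n + 1) = next (p n) := Function.iterate_succ_apply' ..
    let x : ℕ → E := fun n => e (p n).1 (p n).2
    have hx (n : ℕ) : (p n).1.tgt = G.s (x n) := he _ (p n).2
    have hx' (n : ℕ) : G.r (x n) = G.s (x (n + 1)) := by
      rw [← hx, hp]
    let t (n : ℕ) : G.BoundaryPath := inf (fun i => x (n + i)) (fun i => hx' (n + i))
    have ht (n : ℕ) : (p n).1.tgt = (t n).src := hx n
    have ht' (n : ℕ) : ∃ h, t n = concat (FinPath.edge G (x n)) (t (n + 1)) h := by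
      have h : (FinPath.edge G (x n)).tgt = (t (n + 1)).src := hx' n
      refine ⟨h, ext_seq (src_concat _ (t (n + 1)) h).symm
        (Eq.trans (funext fun i => ?_) (seq_concat _ (t (n + 1)) h).symm)⟩
      cases i with
      | zero => rfl
      | succ i => exact congrArg some (congrArg x (by omega))
    have htc (n : ℕ) : concat (p n).1 (t n) (ht n) = t 0 := by
      induction n with
      | zero => exact concat_of_nil hv _ _
      | succ n ih =>
        obtain ⟨h, h'⟩ := ht' n
        have h3 : concat ((p n).1.comp (FinPath.edge G (x n)) (hx n)) (t (n + 1)) h = t 0 := by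
          rw [concat_comp]
          simp only [← h']
          exact ih
        rw [← h3]
        congr 1
        exact congrArg Subtype.val (hp n)
    have hα : α.tgt = (t 0).src := ht 0
    have hβ : β.tgt = (t 0).src := htgt.symm.trans hα
    refine ⟨arr α β (t 0) hα hβ, arr_mem_Z .., ?_⟩
    intro O hO
    obtain ⟨O', hO'O, hO', hgO'⟩ := mem_nhds_iff.1 hO
    obtain ⟨μ, y, hy, h1, h2, F, h3, hF, h4, h5⟩ := exists_ZF_subset hO' _ _ _ _ _ hgO'
    refine mem_of_superset ?_ (h5.trans hO'O)
    -- compare `μ` with a longer initial segment of the infinite path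
    have hlen (n : ℕ) : (p n).1.length = n := by
      induction n with
      | zero => rfl
      | succ n ih =>
        rw [hp]
        show ((p n).1.comp _ (hx n)).length = _
        rw [FinPath.length_comp, ih]
        rfl
    obtain ⟨ν, h6, h7, h8, rfl⟩ := concat_eq_concat ((htc (μ.length + 1)).trans h3)
      (by rw [hlen]; omega)
    have hν : ν.edges ≠ [] := by
      have := congrArg FinPath.length h8
      rw [hlen, FinPath.length_comp] at this
      intro h
      have h0 : ν.length = 0 := by simp [FinPath.length, h]
      omega
    obtain ⟨h9, h10, h11⟩ := (p (μ.length + 1)).2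
    simp only [h8] at h11
    have e1 : α.comp (μ.comp ν h6) h1 = (α.comp μ h1).comp ν h6 := (FinPath.comp_assoc ..).symm
    have e2 : β.comp (μ.comp ν h6) h2 = (β.comp μ h2).comp ν h6 := (FinPath.comp_assoc ..).symm
    rw [e1, e2] at h11
    refine mem_of_superset h11 (Z_comp_subset_ZF hν ?_ h4)
    rw [← arr_comp (α.comp μ h1) (β.comp μ h2) ν _ h6 h6 h7]
    exact arr_mem_Z ..
  · -- the ultrafilter converges to an arrow given by a finite path
    push Not at hstep
    obtain ⟨μ, ⟨h1, h2, hμ⟩, hn⟩ := hstep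
    have hne (e : E) (h : μ.tgt = G.s e) :
        Z ((α.comp μ h1).comp (FinPath.edge G e) h) ((β.comp μ h2).comp (FinPath.edge G e) h)
          ∉ f := by
      intro h'
      refine hn e h ⟨h1, h2, ?_⟩
      simpa only [FinPath.comp_assoc] using h'
    have hF (F : Finset E) : ZF (α.comp μ h1) (β.comp μ h2) F ∈ f := by
      classical
      rw [ZF, Ultrafilter.sdiff_mem_iff]
      refine ⟨hμ, ?_⟩
      induction F using Finset.induction_on with
      | empty => simp
      | insert a F ha ih =>
        intro h
        have : ({g | ∃ e ∈ F, ∃ (hα : (α.comp μ h1).tgt = G.s e) (hβ : (β.comp μ h2).tgt = G.s e),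
            g ∈ Z ((α.comp μ h1).comp (FinPath.edge G e) hα)
              ((β.comp μ h2).comp (FinPath.edge G e) hβ)} ∪
            {g | ∃ (hα : (α.comp μ h1).tgt = G.s a) (hβ : (β.comp μ h2).tgt = G.s a),
            g ∈ Z ((α.comp μ h1).comp (FinPath.edge G a) hα)
              ((β.comp μ h2).comp (FinPath.edge G a) hβ)}) ∈ f := by
          refine mem_of_superset h ?_
          rintro g ⟨e, he, h'⟩
          rcases Finset.mem_insert.1 he with rfl | he
          · exact Or.inr h'
          · exact Or.inl ⟨e, he, h'⟩
        rcases Ultrafilter.union_mem_iff.1 this with h' | h'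
        · exact ih h'
        · by_cases hs : μ.tgt = G.s a
          · refine hne a hs (mem_of_superset h' ?_)
            rintro g ⟨_, _, hg⟩
            exact hg
          · obtain ⟨g, hg, -⟩ := f.nonempty_of_mem h'
            exact hs hg
    have hsing : G.IsSink μ.tgt ∨ G.IsInfiniteEmitter μ.tgt := by
      by_cases hfin : (G.s ⁻¹' {μ.tgt}).Finite
      · left
        by_contra hns
        obtain ⟨g, hg⟩ := f.nonempty_of_mem (hF hfin.toFinset)
        obtain ⟨x, hx, hx', rfl⟩ := hg.1
        have := arr_mem_ZF_iff.1 hg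
        rcases x.cases_edge with ⟨hs, h3⟩ | ⟨e, y, hy, h3⟩
        · rw [h3] at hx
          have hx : μ.tgt = x.src := hx
          rcases hs with hs | hs
          · exact hns (hx ▸ hs)
          · exact hs (hx ▸ hfin)
        · refine this e ?_ y hy h3
          subst h3
          rw [hfin.mem_toFinset]
          exact (hx.trans (src_concat _ _ _)).symm
      · exact Or.inr hfin
    let x : G.BoundaryPath := fin (FinPath.vertex G μ.tgt) hsing
    have hx : μ.tgt = x.src := rfl
    refine ⟨arr (α.comp μ h1) (β.comp μ h2) x hx hx,
      Z_comp_subset α β μ h1 h2 (arr_mem_Z (α.comp μ h1) (β.comp μ h2) x hx hx), ?_⟩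
    intro O hO
    obtain ⟨O', hO'O, hO', hgO'⟩ := mem_nhds_iff.1 hO
    obtain ⟨ν, y, hy, h3, h4, F, h5, -, h6, h7⟩ := exists_ZF_subset hO' _ _ _ _ _ hgO'
    have hν : ν.edges = [] := by
      have := congrFun (congrArg BoundaryPath.seq h5) 0
      rw [seq_concat] at this
      rcases hl : ν.edges with _ | ⟨e, l⟩
      · rfl
      · rw [hl] at this
        cases this
    simp only [FinPath.comp_of_nil _ hν] at h7
    exact mem_of_superset (hF F) (h7.trans hO'O)

theorem isCompactOpenBisection_Z (α β : G.FinPath) : IsCompactOpenBisection (Z α β) := by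
  refine ⟨isCompact_Z, isOpenBisection_iff.2 ⟨isOpen_Z α β, ?_, ?_⟩⟩
  · rintro _ ⟨x, h1, h2, rfl⟩ _ ⟨y, h3, h4, rfl⟩ h
    obtain rfl : x = y := concat_injective h
    rfl
  · rintro _ ⟨x, h1, h2, rfl⟩ _ ⟨y, h3, h4, rfl⟩ h
    obtain rfl : x = y := concat_injective h
    rfl

theorem isCompactOpenBisection_empty : IsCompactOpenBisection (∅ : Set G.Groupoid) :=
  ⟨isCompact_empty, isOpenBisection_iff.2 ⟨isOpen_empty, injOn_empty _, injOn_empty _⟩⟩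

theorem comp_assoc (g h k : G.Groupoid) (h1 : g.src = h.rng) (h2 : h.src = k.rng) :
    (g.comp h h1).comp k h2 = g.comp (h.comp k h2) h1 := by
  ext1
  · rfl
  · exact add_assoc _ _ _
  · rfl

theorem setMul_assoc (U V W : Set G.Groupoid) :
    setMul (setMul U V) W = setMul U (setMul V W) := by
  ext γ
  constructor
  · rintro ⟨_, ⟨g, hg, h, hh, h1, rfl⟩, k, hk, h2, rfl⟩
    exact ⟨g, hg, _, ⟨h, hh, k, hk, h2, rfl⟩, h1, (comp_assoc g h k h1 h2).symm⟩
  · rintro ⟨g, hg, _, ⟨h, hh, k, hk, h2, rfl⟩, h1, rfl⟩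
    exact ⟨_, ⟨g, hg, h, hh, h1, rfl⟩, k, hk, h2, comp_assoc g h k h1 h2⟩

end Groupoid

open Groupoid

section Steinberg

variable (S : Type*) [CommSemiring S]

/-- The underlying semimodule of `A_S(𝒢_E)`: the span of the characteristic functions of the compact
open bisections. -/
def steinbergModule : Submodule S (G.Groupoid → S) :=
  Submodule.span S {f | ∃ U : Set G.Groupoid, IsCompactOpenBisection U ∧ f = U.indicator 1}

variable {S G}

/-- Convolution: `(f * g)(γ)` is the sum of `f(α) g(β)` over all composable pairs `(α, β)` with
`αβ = γ`. For functions in `steinbergModule` the sum has finitely many nonzero terms. -/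
noncomputable def conv (f g : G.Groupoid → S) (γ : G.Groupoid) : S :=
  ∑ᶠ p ∈ {p : G.Groupoid × G.Groupoid | ∃ hc : p.1.src = p.2.rng, p.1.comp p.2 hc = γ},
    f p.1 * g p.2

theorem finite_rng_fiber {f : G.Groupoid → S} (hf : f ∈ G.steinbergModule S)
    (x : G.BoundaryPath) : {g : G.Groupoid | g.rng = x ∧ f g ≠ 0}.Finite := by
  induction hf using Submodule.span_induction with
  | mem f hf =>
    obtain ⟨U, hU, rfl⟩ := hf
    refine Set.Subsingleton.finite ?_
    rintro g ⟨hg, hg'⟩ h ⟨hh, hh'⟩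
    exact (isOpenBisection_iff.1 hU.2).2.2 (mem_of_indicator_ne_zero hg')
      (mem_of_indicator_ne_zero hh') (hg.trans hh.symm)
  | zero => simp
  | add f f' _ _ ih ih' =>
    refine (ih.union ih').subset ?_
    rintro g ⟨hg, hg'⟩
    by_cases h : f g = 0
    · refine Or.inr ⟨hg, fun h' => hg' ?_⟩
      simp [h, h']
    · exact Or.inl ⟨hg, h⟩
  | smul a f _ ih =>
    refine ih.subset ?_
    rintro g ⟨hg, hg'⟩
    exact ⟨hg, fun h => hg' (by simp [h])⟩

theorem finite_conv {f : G.Groupoid → S} (hf : f ∈ G.steinbergModule S) (g : G.Groupoid → S)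
    (γ : G.Groupoid) :
    ({p : G.Groupoid × G.Groupoid | ∃ hc : p.1.src = p.2.rng, p.1.comp p.2 hc = γ} ∩
      Function.support fun p => f p.1 * g p.2).Finite := by
  refine Set.Finite.of_finite_image ((finite_rng_fiber hf γ.rng).subset ?_)
    (f := Prod.fst) ?_
  · rintro _ ⟨⟨a, b⟩, ⟨⟨hc, rfl⟩, h⟩, rfl⟩
    exact ⟨rfl, left_ne_zero_of_mul h⟩
  · rintro ⟨a, b⟩ ⟨⟨hc, h⟩, -⟩ ⟨a', b'⟩ ⟨⟨hc', h'⟩, -⟩ he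
    exact Prod.ext he (comp_left_cancel he (h.trans h'.symm))

theorem conv_add_left {f f' : G.Groupoid → S} (hf : f ∈ G.steinbergModule S)
    (hf' : f' ∈ G.steinbergModule S) (g : G.Groupoid → S) :
    conv (f + f') g = conv f g + conv f' g := by
  funext γ
  simp only [conv, Pi.add_apply, add_mul]
  exact finsum_mem_add_distrib' (finite_conv hf g γ) (finite_conv hf' g γ)

theorem conv_add_right {f : G.Groupoid → S} (hf : f ∈ G.steinbergModule S)
    (g g' : G.Groupoid → S) : conv f (g + g') = conv f g + conv f g' := by
  funext γ
  simp only [conv, Pi.add_apply, mul_add]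
  exact finsum_mem_add_distrib' (finite_conv hf g γ) (finite_conv hf g' γ)

theorem conv_smul_left {f : G.Groupoid → S} (hf : f ∈ G.steinbergModule S) (a : S)
    (g : G.Groupoid → S) : conv (a • f) g = a • conv f g := by
  funext γ
  simp only [conv, Pi.smul_apply, smul_mul_assoc]
  exact ((DistribSMul.toAddMonoidHom S a).map_finsum_mem' (finite_conv hf g γ)).symm

theorem conv_smul_right {f : G.Groupoid → S} (hf : f ∈ G.steinbergModule S) (a : S)
    (g : G.Groupoid → S) : conv f (a • g) = a • conv f g := by
  funext γ
  simp only [conv, Pi.smul_apply, mul_smul_comm]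
  exact ((DistribSMul.toAddMonoidHom S a).map_finsum_mem' (finite_conv hf g γ)).symm

@[simp] theorem conv_zero_left (g : G.Groupoid → S) : conv 0 g = 0 := by
  funext γ
  simp [conv]

@[simp] theorem conv_zero_right (f : G.Groupoid → S) : conv f 0 = 0 := by
  funext γ
  simp [conv]

theorem indicator_mem {U : Set G.Groupoid} (hU : IsCompactOpenBisection U) :
    (U.indicator 1 : G.Groupoid → S) ∈ G.steinbergModule S :=
  Submodule.subset_span ⟨U, hU, rfl⟩

theorem conv_indicator {U V : Set G.Groupoid} (hU : IsCompactOpenBisection U) :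
    conv (U.indicator 1 : G.Groupoid → S) (V.indicator 1) = (setMul U V).indicator 1 := by
  classical
  funext γ
  by_cases hγ : γ ∈ setMul U V
  · rw [indicator_of_mem hγ]
    obtain ⟨g, hg, h, hh, hc, rfl⟩ := hγ
    rw [conv, finsum_eq_single _ (g, h)]
    · rw [finsum_eq_if, if_pos ⟨hc, rfl⟩]
      simp [hg, hh]
    · rintro ⟨g', h'⟩ hne
      rw [finsum_eq_if]
      split_ifs with hp
      · obtain ⟨hc', he⟩ := hp
        by_cases hg' : g' ∈ U
        · exfalso
          have hr := congrArg rng he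
          have : g' = g := (isOpenBisection_iff.1 hU.2).2.2 hg' hg hr
          exact hne (Prod.ext this (comp_left_cancel this he))
        · simp [hg']
      · rfl
  · rw [indicator_of_notMem hγ, conv]
    refine finsum_mem_eq_zero_of_forall_eq_zero ?_
    rintro ⟨g, h⟩ ⟨hc, he⟩
    by_cases hg : g ∈ U
    · by_cases hh : h ∈ V
      · exact (hγ ⟨g, hg, h, hh, hc, he⟩).elim
      · simp [hh]
    · simp [hg]

theorem conv_mem {f g : G.Groupoid → S} (hf : f ∈ G.steinbergModule S)
    (hg : g ∈ G.steinbergModule S) : conv f g ∈ G.steinbergModule S := by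
  induction hf using Submodule.span_induction with
  | mem f hf =>
    obtain ⟨U, hU, rfl⟩ := hf
    induction hg using Submodule.span_induction with
    | mem g hg =>
      obtain ⟨V, hV, rfl⟩ := hg
      rw [conv_indicator hU]
      exact indicator_mem (hU.setMul hV)
    | zero => simp
    | add g g' _ _ ih ih' =>
      rw [conv_add_right (indicator_mem hU)]
      exact add_mem ih ih'
    | smul a g _ ih =>
      rw [conv_smul_right (indicator_mem hU)]
      exact Submodule.smul_mem _ _ ih
  | zero => simp
  | add f f' hf hf' ih ih' =>
    rw [conv_add_left hf hf']
    exact add_mem ih ih'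
  | smul a f hf ih =>
    rw [conv_smul_left hf]
    exact Submodule.smul_mem _ _ ih

theorem conv_assoc {f g h : G.Groupoid → S} (hf : f ∈ G.steinbergModule S)
    (hg : g ∈ G.steinbergModule S) (hh : h ∈ G.steinbergModule S) :
    conv (conv f g) h = conv f (conv g h) := by
  induction hf using Submodule.span_induction with
  | mem f hf =>
    obtain ⟨U, hU, rfl⟩ := hf
    induction hg using Submodule.span_induction with
    | mem g hg =>
      obtain ⟨V, hV, rfl⟩ := hg
      induction hh using Submodule.span_induction with
      | mem h hh =>
        obtain ⟨W, hW, rfl⟩ := hh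
        rw [conv_indicator hU, conv_indicator hV, conv_indicator (hU.setMul hV),
          conv_indicator hU, setMul_assoc]
      | zero => simp
      | add h h' _ _ ih ih' =>
        rw [conv_add_right (indicator_mem hV), conv_add_right (indicator_mem hU),
          conv_add_right (conv_mem (indicator_mem hU) (indicator_mem hV)), ih, ih']
      | smul a h _ ih =>
        rw [conv_smul_right (indicator_mem hV), conv_smul_right (indicator_mem hU),
          conv_smul_right (conv_mem (indicator_mem hU) (indicator_mem hV)), ih]
    | zero => simp
    | add g g' hg hg' ih ih' =>
      rw [conv_add_left hg hg', conv_add_right (indicator_mem hU),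
        conv_add_right (indicator_mem hU),
        conv_add_left (conv_mem (indicator_mem hU) hg) (conv_mem (indicator_mem hU) hg'), ih, ih']
    | smul a g hg ih =>
      rw [conv_smul_left hg, conv_smul_right (indicator_mem hU),
        conv_smul_right (indicator_mem hU), conv_smul_left (conv_mem (indicator_mem hU) hg), ih]
  | zero => simp
  | add f f' hf hf' ih ih' =>
    rw [conv_add_left hf hf', conv_add_left hf hf',
      conv_add_left (conv_mem hf hg) (conv_mem hf' hg), ih, ih']
  | smul a f hf ih =>
    rw [conv_smul_left hf, conv_smul_left hf, conv_smul_left (conv_mem hf hg), ih]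

variable (S G)

/-- The Steinberg algebra `A_S(𝒢_E)` of the graph groupoid, with the convolution product. -/
def SteinbergAlgebra : Type _ := G.steinbergModule S

namespace SteinbergAlgebra

noncomputable instance : AddCommMonoid (G.SteinbergAlgebra S) :=
  inferInstanceAs (AddCommMonoid (G.steinbergModule S))

noncomputable instance : Module S (G.SteinbergAlgebra S) :=
  inferInstanceAs (Module S (G.steinbergModule S))

noncomputable instance : Mul (G.SteinbergAlgebra S) :=
  ⟨fun f g => ⟨conv f.1 g.1, conv_mem f.2 g.2⟩⟩

noncomputable instance : NonUnitalSemiring (G.SteinbergAlgebra S) where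
  left_distrib f g h := Subtype.ext (conv_add_right f.2 g.1 h.1)
  right_distrib f g h := Subtype.ext (conv_add_left f.2 g.2 h.1)
  zero_mul f := Subtype.ext (conv_zero_left f.1)
  mul_zero f := Subtype.ext (conv_zero_right f.1)
  mul_assoc f g h := Subtype.ext (conv_assoc f.2 g.2 h.2)

instance : IsScalarTower S (G.SteinbergAlgebra S) (G.SteinbergAlgebra S) :=
  ⟨fun a f g => Subtype.ext (conv_smul_left f.2 a g.1)⟩

instance : SMulCommClass S (G.SteinbergAlgebra S) (G.SteinbergAlgebra S) :=
  ⟨fun a f g => Subtype.ext (conv_smul_right f.2 a g.1).symm⟩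

variable {S G}

/-- The characteristic function of `Z(α, β)`, as an element of the Steinberg algebra. -/
noncomputable def charZ (α β : G.FinPath) : G.SteinbergAlgebra S :=
  ⟨(Z α β).indicator 1, indicator_mem (isCompactOpenBisection_Z α β)⟩

theorem charZ_mul_eq_zero {α β γ δ : G.FinPath} (h : setMul (Z α β) (Z γ δ) = ∅) :
    (charZ α β * charZ γ δ : G.SteinbergAlgebra S) = 0 := by
  refine Subtype.ext ((conv_indicator (isCompactOpenBisection_Z α β)).trans ?_)
  rw [h, indicator_empty]
  rfl

theorem charZ_mul {α β γ δ κ η : G.FinPath} (h : setMul (Z α β) (Z γ δ) = Z κ η) :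
    (charZ α β * charZ γ δ : G.SteinbergAlgebra S) = charZ κ η := by
  refine Subtype.ext ((conv_indicator (isCompactOpenBisection_Z α β)).trans ?_)
  rw [h]
  rfl

theorem setMul_Z (α β δ : G.FinPath) (h : α.tgt = β.tgt) :
    setMul (Z α β) (Z β δ) = Z α δ := by
  ext γ
  constructor
  · rintro ⟨_, ⟨x, h1, h2, rfl⟩, _, ⟨y, h3, h4, rfl⟩, hc, rfl⟩
    obtain rfl : x = y := concat_injective hc
    exact ⟨x, h1, h4, arr_comp_arr ..⟩
  · rintro ⟨x, h1, h2, rfl⟩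
    have h3 : β.tgt = x.src := h.symm.trans h1
    exact ⟨arr α β x h1 h3, arr_mem_Z .., arr β δ x h3 h2, arr_mem_Z .., rfl, arr_comp_arr ..⟩

theorem mem_Z_vertex {v : V} {g : G.Groupoid} :
    g ∈ Z (FinPath.vertex G v) (FinPath.vertex G v) ↔ ∃ x : G.BoundaryPath, x.src = v ∧
      g = unit x := by
  constructor
  · rintro ⟨x, h, -, rfl⟩
    refine ⟨x, h.symm, ?_⟩
    rw [← unit_concat, concat_of_nil rfl]
  · rintro ⟨x, rfl, rfl⟩
    refine ⟨x, rfl, rfl, ?_⟩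
    rw [← unit_concat, concat_of_nil rfl]

theorem vertex_setMul {v : V} {U : Set G.Groupoid} (hU : ∀ g ∈ U, g.rng.src = v) :
    setMul (Z (FinPath.vertex G v) (FinPath.vertex G v)) U = U := by
  ext γ
  constructor
  · rintro ⟨g, hg, h, hh, hc, rfl⟩
    obtain ⟨x, -, rfl⟩ := mem_Z_vertex.1 hg
    convert hh using 1
    ext1
    · exact hc
    · exact zero_add _
    · rfl
  · intro hγ
    refine ⟨unit γ.rng, mem_Z_vertex.2 ⟨_, hU γ hγ, rfl⟩, γ, hγ, rfl, ?_⟩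
    ext1
    · rfl
    · exact zero_add _
    · rfl

theorem setMul_vertex {v : V} {U : Set G.Groupoid} (hU : ∀ g ∈ U, g.src.src = v) :
    setMul U (Z (FinPath.vertex G v) (FinPath.vertex G v)) = U := by
  ext γ
  constructor
  · rintro ⟨g, hg, h, hh, hc, rfl⟩
    obtain ⟨x, -, rfl⟩ := mem_Z_vertex.1 hh
    convert hg using 1
    ext1
    · rfl
    · exact add_zero _
    · exact hc.symm
  · intro hγ
    refine ⟨γ, hγ, unit γ.src, mem_Z_vertex.2 ⟨_, hU γ hγ, rfl⟩, rfl, ?_⟩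
    ext1
    · rfl
    · exact add_zero _
    · rfl

theorem rng_src_of_mem_Z {α β : G.FinPath} {g : G.Groupoid} (hg : g ∈ Z α β) :
    g.rng.src = α.src := by
  obtain ⟨x, h, _, rfl⟩ := hg
  exact src_concat _ _ _

theorem src_src_of_mem_Z {α β : G.FinPath} {g : G.Groupoid} (hg : g ∈ Z α β) :
    g.src.src = β.src := by
  obtain ⟨x, _, h, rfl⟩ := hg
  exact src_concat _ _ _

theorem setMul_Z_edge_eq_empty {e f : E} (hef : e ≠ f) {α β : G.FinPath} :
    setMul (Z α (FinPath.edge G e)) (Z (FinPath.edge G f) β) = ∅ := by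
  refine eq_empty_iff_forall_notMem.2 ?_
  rintro _ ⟨_, ⟨x, h1, h2, rfl⟩, _, ⟨y, h3, h4, rfl⟩, hc, rfl⟩
  obtain ⟨μ, h5, h6, h7, -⟩ := concat_eq_concat hc (by simp)
  have := congrArg FinPath.edges h7
  simp only [List.singleton_append, List.cons.injEq] at this
  exact hef this.1

theorem setMul_Z_vertex_eq_empty {v w : V} (hvw : v ≠ w) :
    setMul (Z (FinPath.vertex G v) (FinPath.vertex G v))
      (Z (FinPath.vertex G w) (FinPath.vertex G w)) = ∅ := by
  refine eq_empty_iff_forall_notMem.2 ?_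
  rintro _ ⟨g, hg, h, hh, hc, rfl⟩
  have h1 := src_src_of_mem_Z hg
  have h2 := rng_src_of_mem_Z hh
  rw [hc] at h1
  exact hvw (h1.symm.trans h2)

theorem charZ_vertex_eq_sum {v : V} (hne : (G.s ⁻¹' {v}).Nonempty) (hfin : (G.s ⁻¹' {v}).Finite) :
    (charZ (FinPath.vertex G v) (FinPath.vertex G v) : G.SteinbergAlgebra S) =
      ∑ e ∈ hfin.toFinset, charZ (FinPath.edge G e) (FinPath.edge G e) := by
  classical
  refine Subtype.ext ?_
  have hsum (F : Finset E) : ((∑ e ∈ F, charZ (FinPath.edge G e) (FinPath.edge G e) :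
      G.SteinbergAlgebra S)).1 =
      ∑ e ∈ F, (Z (FinPath.edge G e) (FinPath.edge G e)).indicator 1 :=
    map_sum (G.steinbergModule S).subtype _ _
  rw [hsum]
  funext g
  rw [Finset.sum_apply]
  show (Z (FinPath.vertex G v) (FinPath.vertex G v)).indicator 1 g = _
  have hedge {f : E} {y : G.BoundaryPath} {h} {e : E} :
      unit (concat (FinPath.edge G f) y h) ∈ Z (FinPath.edge G e) (FinPath.edge G e) → f = e := by
    rintro ⟨z, hz, _, h'⟩
    obtain ⟨μ, _, _, h7, -⟩ := concat_eq_concat (congrArg rng h') (by simp)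
    have := congrArg FinPath.edges h7
    simp only [List.singleton_append, List.cons.injEq] at this
    exact this.1
  by_cases hg : g ∈ Z (FinPath.vertex G v) (FinPath.vertex G v)
  · rw [indicator_of_mem hg]
    obtain ⟨x, rfl, rfl⟩ := mem_Z_vertex.1 hg
    rcases x.cases_edge with ⟨hx, -⟩ | ⟨f, y, h, h1⟩
    · exfalso
      rcases hx with hx | hx
      · exact hne.ne_empty hx
      · exact hx hfin
    · have hf : f ∈ hfin.toFinset := by
        rw [hfin.mem_toFinset, h1]
        exact (src_concat (FinPath.edge G f) y h).symm
      rw [Finset.sum_eq_single_of_mem f hf, indicator_of_mem]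
      · rw [h1, unit_concat]
        exact arr_mem_Z ..
      · intro e _ hef
        refine indicator_of_notMem (fun h' => hef ?_) _
        rw [h1] at h'
        exact (hedge h').symm
  · rw [indicator_of_notMem hg]
    refine (Finset.sum_eq_zero fun e he => indicator_of_notMem (fun h => hg ?_) _).symm
    rw [hfin.mem_toFinset] at he
    obtain ⟨x, hx, _, rfl⟩ := h
    rw [← unit_concat]
    exact mem_Z_vertex.2 ⟨_, (src_concat (FinPath.edge G e) x hx).trans he, rfl⟩

end SteinbergAlgebra

end Steinberg

/-- The generators of the Leavitt path algebra: the vertices, the edges `e` and the ghost edges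
`e^*`. -/
inductive LeavittGen (V E : Type*) where
  | vertex (v : V) : LeavittGen V E
  | edge (e : E) : LeavittGen V E
  | ghost (e : E) : LeavittGen V E

section Leavitt

variable (S : Type*) [CommSemiring S]

/-- The free (not necessarily unital) associative `S`-algebra on the vertices, edges and ghost
edges, that is, the semigroup algebra of the free semigroup. -/
abbrev LeavittFree (V E : Type*) : Type _ := MonoidAlgebra S (FreeSemigroup (LeavittGen V E))

namespace LeavittFree

variable {S}

noncomputable def gen (x : LeavittGen V E) : LeavittFree S V E :=
  MonoidAlgebra.single (FreeSemigroup.of x) 1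

end LeavittFree

open LeavittFree LeavittGen

/-- The defining relations of the Leavitt path algebra. -/
inductive LeavittRel : LeavittFree S V E → LeavittFree S V E → Prop
  | vertex_mul_self (v : V) : LeavittRel (gen (vertex v) * gen (vertex v)) (gen (vertex v))
  | vertex_mul_vertex (v w : V) (h : v ≠ w) : LeavittRel (gen (vertex v) * gen (vertex w)) 0
  | source_mul_edge (e : E) : LeavittRel (gen (vertex (G.s e)) * gen (edge e)) (gen (edge e))
  | edge_mul_range (e : E) : LeavittRel (gen (edge e) * gen (vertex (G.r e))) (gen (edge e))
  | range_mul_ghost (e : E) : LeavittRel (gen (vertex (G.r e)) * gen (ghost e)) (gen (ghost e))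
  | ghost_mul_source (e : E) : LeavittRel (gen (ghost e) * gen (vertex (G.s e))) (gen (ghost e))
  | ghost_mul_self (e : E) : LeavittRel (gen (ghost e) * gen (edge e)) (gen (vertex (G.r e)))
  | ghost_mul_edge (e f : E) (h : e ≠ f) : LeavittRel (gen (ghost e) * gen (edge f)) 0
  | regular (v : V) (hv : G.IsRegular v) :
      LeavittRel (gen (vertex v)) (∑ e ∈ hv.2.toFinset, gen (edge e) * gen (ghost e))

/-- The `S`-algebra congruence generated by the relations; it is the congruence with respect to
addition and multiplication generated by the scalar multiples of the relations. -/
noncomputable def leavittCon : RingCon (LeavittFree S V E) :=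
  ringConGen fun a b => ∃ (c : S) (x y : LeavittFree S V E),
    G.LeavittRel S x y ∧ a = c • x ∧ b = c • y

theorem leavittCon_smul (c : S) {a b : LeavittFree S V E} (h : G.leavittCon S a b) :
    G.leavittCon S (c • a) (c • b) := by
  replace h : RingConGen.Rel _ a b := h
  induction h with
  | of a b hab =>
    obtain ⟨d, x, y, hxy, rfl, rfl⟩ := hab
    exact RingConGen.Rel.of _ _ ⟨c * d, x, y, hxy, (mul_smul ..).symm, (mul_smul ..).symm⟩
  | refl a => exact (G.leavittCon S).refl _
  | symm h ih => exact (G.leavittCon S).symm ih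
  | trans h1 h2 ih1 ih2 => exact (G.leavittCon S).trans ih1 ih2
  | add h1 h2 ih1 ih2 =>
    rw [smul_add, smul_add]
    exact (G.leavittCon S).add ih1 ih2
  | mul h1 h2 ih1 ih2 =>
    rw [← smul_mul_assoc, ← smul_mul_assoc]
    exact (G.leavittCon S).mul ih1 h2

/-- The Leavitt path algebra `L_S(E)`. -/
def LeavittPathAlgebra : Type _ := (G.leavittCon S).Quotient

namespace LeavittPathAlgebra

noncomputable instance : NonUnitalSemiring (G.LeavittPathAlgebra S) :=
  inferInstanceAs (NonUnitalSemiring (G.leavittCon S).Quotient)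

variable {S G} in
/-- The class in the Leavitt path algebra of an element of the free algebra. -/
noncomputable def mk (a : LeavittFree S V E) : G.LeavittPathAlgebra S := RingCon.toQuotient a

variable {S G} in
theorem mk_surjective : Function.Surjective (mk : LeavittFree S V E → G.LeavittPathAlgebra S) :=
  Quotient.mk''_surjective

noncomputable instance : SMul S (G.LeavittPathAlgebra S) :=
  ⟨fun c => Quotient.map' (c • ·) fun _ _ h => G.leavittCon_smul S c h⟩

noncomputable instance : Module S (G.LeavittPathAlgebra S) where
  one_smul a := by
    obtain ⟨a, rfl⟩ := mk_surjective a
    exact congrArg mk (one_smul S a)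
  mul_smul c d a := by
    obtain ⟨a, rfl⟩ := mk_surjective a
    exact congrArg mk (mul_smul c d a)
  smul_zero c := congrArg mk (smul_zero c)
  smul_add c a b := by
    obtain ⟨a, rfl⟩ := mk_surjective a
    obtain ⟨b, rfl⟩ := mk_surjective b
    exact congrArg mk (smul_add c a b)
  add_smul c d a := by
    obtain ⟨a, rfl⟩ := mk_surjective a
    exact congrArg mk (add_smul c d a)
  zero_smul a := by
    obtain ⟨a, rfl⟩ := mk_surjective a
    exact congrArg mk (zero_smul S a)

instance : IsScalarTower S (G.LeavittPathAlgebra S) (G.LeavittPathAlgebra S) where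
  smul_assoc c a b := by
    obtain ⟨a, rfl⟩ := mk_surjective a
    obtain ⟨b, rfl⟩ := mk_surjective b
    exact congrArg mk (smul_mul_assoc c a b)

instance : SMulCommClass S (G.LeavittPathAlgebra S) (G.LeavittPathAlgebra S) where
  smul_comm c a b := by
    obtain ⟨a, rfl⟩ := mk_surjective a
    obtain ⟨b, rfl⟩ := mk_surjective b
    exact congrArg mk (mul_smul_comm c a b).symm

variable {S G}

/-- The universal property, existence part. -/
noncomputable def lift {A : Type*} [NonUnitalSemiring A] [Module S A] [IsScalarTower S A A]
    [SMulCommClass S A A] (φ : LeavittGen V E → A)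
    (hφ : ∀ x y, G.LeavittRel S x y → MonoidAlgebra.liftMagma S (FreeSemigroup.lift φ) x =
      MonoidAlgebra.liftMagma S (FreeSemigroup.lift φ) y) :
    G.LeavittPathAlgebra S →ₙₐ[S] A :=
  let Φ : LeavittFree S V E →ₙₐ[S] A := MonoidAlgebra.liftMagma S (FreeSemigroup.lift φ)
  have hΦ : ∀ a b, G.leavittCon S a b → Φ a = Φ b := by
    intro a b h
    replace h : RingConGen.Rel _ a b := h
    induction h with
    | of a b hab =>
      obtain ⟨d, x, y, hxy, rfl, rfl⟩ := hab
      rw [map_smul, map_smul]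
      exact congrArg (d • ·) (hφ x y hxy)
    | refl a => rfl
    | symm h ih => exact ih.symm
    | trans h1 h2 ih1 ih2 => exact ih1.trans ih2
    | add h1 h2 ih1 ih2 => rw [map_add, map_add, ih1, ih2]
    | mul h1 h2 ih1 ih2 => rw [map_mul, map_mul, ih1, ih2]
  { toFun := Quotient.lift Φ hΦ
    map_smul' := fun c a => by
      obtain ⟨a, rfl⟩ := mk_surjective a
      exact map_smul Φ c a
    map_zero' := map_zero Φ
    map_add' := fun a b => by
      obtain ⟨a, rfl⟩ := mk_surjective a
      obtain ⟨b, rfl⟩ := mk_surjective b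
      exact map_add Φ a b
    map_mul' := fun a b => by
      obtain ⟨a, rfl⟩ := mk_surjective a
      obtain ⟨b, rfl⟩ := mk_surjective b
      exact map_mul Φ a b }

theorem liftMagma_gen {A : Type*} [NonUnitalSemiring A] [Module S A] [IsScalarTower S A A]
    [SMulCommClass S A A] (φ : LeavittGen V E → A) (x : LeavittGen V E) :
    MonoidAlgebra.liftMagma S (FreeSemigroup.lift φ) (gen x) = φ x := by
  simp [gen]

theorem lift_mk_gen {A : Type*} [NonUnitalSemiring A] [Module S A] [IsScalarTower S A A]
    [SMulCommClass S A A] (φ : LeavittGen V E → A) (hφ) (x : LeavittGen V E) :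
    lift (G := G) (S := S) φ hφ (mk (gen x)) = φ x :=
  liftMagma_gen φ x

end LeavittPathAlgebra

open SteinbergAlgebra in
/-- The elements of the Steinberg algebra that the natural homomorphism assigns to the generators:
`v ↦ 1_{Z(v, v)}`, `e ↦ 1_{Z(e, r(e))}` and `e^* ↦ 1_{Z(r(e), e)}`. -/
noncomputable def naturalGen : LeavittGen V E → G.SteinbergAlgebra S
  | vertex v => charZ (FinPath.vertex G v) (FinPath.vertex G v)
  | edge e => charZ (FinPath.edge G e) (FinPath.vertex G (G.r e))
  | ghost e => charZ (FinPath.vertex G (G.r e)) (FinPath.edge G e)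

open SteinbergAlgebra in
theorem naturalGen_rel (x y : LeavittFree S V E) (h : G.LeavittRel S x y) :
    MonoidAlgebra.liftMagma S (FreeSemigroup.lift (G.naturalGen S)) x =
      MonoidAlgebra.liftMagma S (FreeSemigroup.lift (G.naturalGen S)) y := by
  induction h with
  | vertex_mul_self v =>
    rw [map_mul, LeavittPathAlgebra.liftMagma_gen]
    exact charZ_mul (setMul_Z _ _ _ rfl)
  | vertex_mul_vertex v w h =>
    rw [map_mul, map_zero, LeavittPathAlgebra.liftMagma_gen, LeavittPathAlgebra.liftMagma_gen]
    exact charZ_mul_eq_zero (setMul_Z_vertex_eq_empty h)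
  | source_mul_edge e =>
    rw [map_mul, LeavittPathAlgebra.liftMagma_gen, LeavittPathAlgebra.liftMagma_gen]
    exact charZ_mul (vertex_setMul fun g hg => rng_src_of_mem_Z hg)
  | edge_mul_range e =>
    rw [map_mul, LeavittPathAlgebra.liftMagma_gen, LeavittPathAlgebra.liftMagma_gen]
    exact charZ_mul (setMul_vertex fun g hg => src_src_of_mem_Z hg)
  | range_mul_ghost e =>
    rw [map_mul, LeavittPathAlgebra.liftMagma_gen, LeavittPathAlgebra.liftMagma_gen]
    exact charZ_mul (vertex_setMul fun g hg => rng_src_of_mem_Z hg)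
  | ghost_mul_source e =>
    rw [map_mul, LeavittPathAlgebra.liftMagma_gen, LeavittPathAlgebra.liftMagma_gen]
    exact charZ_mul (setMul_vertex fun g hg => src_src_of_mem_Z hg)
  | ghost_mul_self e =>
    rw [map_mul, LeavittPathAlgebra.liftMagma_gen, LeavittPathAlgebra.liftMagma_gen,
      LeavittPathAlgebra.liftMagma_gen]
    exact charZ_mul (setMul_Z _ _ _ rfl)
  | ghost_mul_edge e f h =>
    rw [map_mul, map_zero, LeavittPathAlgebra.liftMagma_gen, LeavittPathAlgebra.liftMagma_gen]
    exact charZ_mul_eq_zero (setMul_Z_edge_eq_empty h)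
  | regular v hv =>
    rw [map_sum, LeavittPathAlgebra.liftMagma_gen]
    refine (charZ_vertex_eq_sum hv.1 hv.2).trans (Finset.sum_congr rfl fun e _ => ?_)
    rw [map_mul, LeavittPathAlgebra.liftMagma_gen, LeavittPathAlgebra.liftMagma_gen]
    exact (charZ_mul (setMul_Z (FinPath.edge G e) (FinPath.vertex G (G.r e))
      (FinPath.edge G e) rfl)).symm

/-- The natural homomorphism `π_E : L_S(E) → A_S(𝒢_E)`, the homomorphism of `S`-algebras with
`π_E(v) = 1_{Z(v, v)}`, `π_E(e) = 1_{Z(e, r(e))}` and `π_E(e^*) = 1_{Z(r(e), e)}`. -/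
noncomputable def naturalHom : G.LeavittPathAlgebra S →ₙₐ[S] G.SteinbergAlgebra S :=
  LeavittPathAlgebra.lift (G.naturalGen S) (G.naturalGen_rel S)

theorem naturalHom_gen (x : LeavittGen V E) :
    G.naturalHom S (LeavittPathAlgebra.mk (gen x : LeavittFree S V E)) = G.naturalGen S x :=
  LeavittPathAlgebra.lift_mk_gen (G.naturalGen S) (G.naturalGen_rel S) x

/-- The natural homomorphism is determined by its values on the generators. -/
theorem naturalHom_unique (φ : G.LeavittPathAlgebra S →ₙₐ[S] G.SteinbergAlgebra S)
    (h : ∀ x, φ (LeavittPathAlgebra.mk (gen x : LeavittFree S V E)) = G.naturalGen S x) :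
    φ = G.naturalHom S := by
  let q : LeavittFree S V E →ₙₐ[S] G.LeavittPathAlgebra S :=
    { toFun := LeavittPathAlgebra.mk
      map_smul' := fun _ _ => rfl
      map_zero' := rfl
      map_add' := fun _ _ => rfl
      map_mul' := fun _ _ => rfl }
  have hq : φ.comp q = (G.naturalHom S).comp q := by
    apply MonoidAlgebra.nonUnitalAlgHom_ext'
    apply FreeSemigroup.hom_ext
    funext x
    exact (h x).trans (G.naturalHom_gen S x).symm
  ext a
  obtain ⟨a, rfl⟩ := LeavittPathAlgebra.mk_surjective a
  exact DFunLike.congr_fun hq a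

end Leavitt

end DirGraph

/-- The Boolean semifield `𝔹 = ({0, 1}, ∨, ∧, 0, 1)`. -/
def BooleanSemifield : Type := Bool

namespace BooleanSemifield

instance : DecidableEq BooleanSemifield := inferInstanceAs (DecidableEq Bool)

instance : Fintype BooleanSemifield := inferInstanceAs (Fintype Bool)

instance : Zero BooleanSemifield := ⟨false⟩

instance : One BooleanSemifield := ⟨true⟩

instance : Add BooleanSemifield := ⟨Bool.or⟩

instance : Mul BooleanSemifield := ⟨Bool.and⟩

instance : CommSemiring BooleanSemifield where
  add_assoc := by decide
  zero_add := by decide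
  add_zero := by decide
  add_comm := by decide
  left_distrib := by decide
  right_distrib := by decide
  zero_mul := by decide
  mul_zero := by decide
  mul_assoc := by decide
  one_mul := by decide
  mul_one := by decide
  mul_comm := by decide
  nsmul := nsmulRec

end BooleanSemifield

/-!
Write `αβ^*` also for the element of `L_𝔹(E)` given by two finite paths with a common range. These
monomials span `L_𝔹(E)` (`mem_monomialSpan`), and `π_E(αβ^*) = 1_{Z(α, β)}` (`naturalHom_monomial`).
As the coefficients are Boolean, `π_E(a)` is determined by its support, and the supports that occur
are the finite unions of sets `Z(α, β)`.

Let `E` be row-finite. A path of `X_E` that is not trivial begins with an edge, and a trivial one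
sits at a sink, so the sets `Z(α, β)` form a base of the topology (`exists_Z_subset`). A compact open
bisection is then a finite union of such sets, and `π_E` is surjective. For injectivity, order the
additively idempotent semiring `L_𝔹(E)` by `a ≤ b ↔ a + b = b`. By antisymmetry it is enough that an
inclusion of supports implies `≤`, that is, that `Z(α, β) ⊆ ⋃ Z(γᵢ, δᵢ)` implies
`αβ^* ≤ ∑ γᵢδᵢ^*` (`monomial_le_of_Z_subset`). If no `γᵢ` is longer than `α`, then any point of
`Z(α, β)` lies in some `Z(γᵢ, δᵢ)`, which forces `α = γᵢμ` and `β = δᵢμ`, and relation (4) along `μ`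
gives `γᵢμ(δᵢμ)^* ≤ γᵢδᵢ^*` (`monomial_comp_le`). The general case follows by induction from the
expansion `αβ^* = ∑ αe(βe)^*` at the range of `α` (`monomial_eq_sum`), or from the only point of
`Z(α, β)` if this range is a sink.

Conversely, let `v` be an infinite emitter and `e` an edge that starts at `v`. The set
`Z(v, v) \ Z(e, e)` is a compact open bisection that contains the unit at the path `v ∈ X_E`. The only
set `Z(α, β)` which contains this unit is `Z(v, v)`, so no union of sets `Z(α, β)` is equal to
`Z(v, v) \ Z(e, e)`: its characteristic function is not in the image of `π_E`.
-/

namespace DirGraph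

open Set Groupoid BoundaryPath LeavittFree LeavittGen

/-! ### Monomials of the Leavitt path algebra -/

section Monomials

variable {V E : Type*} {G : DirGraph V E} {S : Type*} [CommSemiring S]

namespace LeavittPathAlgebra

/-- The class of a generator in the Leavitt path algebra. -/
noncomputable def of (x : LeavittGen V E) : G.LeavittPathAlgebra S := mk (gen x)

theorem mk_eq_mk_of_rel {x y : LeavittFree S V E} (h : G.LeavittRel S x y) :
    (mk x : G.LeavittPathAlgebra S) = mk y :=
  (RingCon.eq _).2 (RingConGen.Rel.of _ _ ⟨1, x, y, h, (one_smul ..).symm, (one_smul ..).symm⟩)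

theorem vertex_mul_self (v : V) :
    (of (vertex v) * of (vertex v) : G.LeavittPathAlgebra S) = of (vertex v) :=
  mk_eq_mk_of_rel (.vertex_mul_self v)

theorem vertex_mul_vertex {v w : V} (h : v ≠ w) :
    (of (vertex v) * of (vertex w) : G.LeavittPathAlgebra S) = 0 :=
  mk_eq_mk_of_rel (.vertex_mul_vertex v w h)

theorem source_mul_edge (e : E) :
    (of (vertex (G.s e)) * of (edge e) : G.LeavittPathAlgebra S) = of (edge e) :=
  mk_eq_mk_of_rel (.source_mul_edge e)

theorem edge_mul_range (e : E) :
    (of (edge e) * of (vertex (G.r e)) : G.LeavittPathAlgebra S) = of (edge e) :=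
  mk_eq_mk_of_rel (.edge_mul_range e)

theorem range_mul_ghost (e : E) :
    (of (vertex (G.r e)) * of (ghost e) : G.LeavittPathAlgebra S) = of (ghost e) :=
  mk_eq_mk_of_rel (.range_mul_ghost e)

theorem ghost_mul_source (e : E) :
    (of (ghost e) * of (vertex (G.s e)) : G.LeavittPathAlgebra S) = of (ghost e) :=
  mk_eq_mk_of_rel (.ghost_mul_source e)

theorem ghost_mul_self (e : E) :
    (of (ghost e) * of (edge e) : G.LeavittPathAlgebra S) = of (vertex (G.r e)) :=
  mk_eq_mk_of_rel (.ghost_mul_self e)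

theorem ghost_mul_edge {e f : E} (h : e ≠ f) :
    (of (ghost e) * of (edge f) : G.LeavittPathAlgebra S) = 0 :=
  mk_eq_mk_of_rel (.ghost_mul_edge e f h)

theorem vertex_eq_sum {v : V} (hv : G.IsRegular v) :
    (of (vertex v) : G.LeavittPathAlgebra S) =
      ∑ e ∈ hv.2.toFinset, of (edge e) * of (ghost e) := by
  let q : LeavittFree S V E →+ G.LeavittPathAlgebra S :=
    { toFun := mk, map_zero' := rfl, map_add' := fun _ _ => rfl }
  refine (mk_eq_mk_of_rel (.regular v hv)).trans ?_
  exact map_sum q _ _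

/-- The product of the edges in the list `l`, seen as a path that starts at `v`. -/
noncomputable def realPath : V → List E → G.LeavittPathAlgebra S
  | v, [] => of (vertex v)
  | _, e :: l => of (edge e) * realPath (G.r e) l

/-- The product, in reverse order, of the ghosts of the edges in the list `l`, seen as a path that
starts at `v`. -/
noncomputable def ghostPath : V → List E → G.LeavittPathAlgebra S
  | v, [] => of (vertex v)
  | _, e :: l => ghostPath (G.r e) l * of (ghost e)

theorem source_mul_realPath {v w : V} {l : List E} (h : G.IsPath v l w) :
    (of (vertex v) * realPath v l : G.LeavittPathAlgebra S) = realPath v l := by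
  cases l with
  | nil => exact vertex_mul_self v
  | cons e l => rw [realPath, ← mul_assoc, ← h.1, source_mul_edge]

theorem realPath_mul_range {v w : V} {l : List E} (h : G.IsPath v l w) :
    (realPath v l * of (vertex w) : G.LeavittPathAlgebra S) = realPath v l := by
  induction l generalizing v with
  | nil => obtain rfl : v = w := h; exact vertex_mul_self v
  | cons e l ih => rw [realPath, mul_assoc, ih h.2]

theorem range_mul_ghostPath {v w : V} {l : List E} (h : G.IsPath v l w) :
    (of (vertex w) * ghostPath v l : G.LeavittPathAlgebra S) = ghostPath v l := by
  induction l generalizing v with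
  | nil => obtain rfl : v = w := h; exact vertex_mul_self v
  | cons e l ih => rw [ghostPath, ← mul_assoc, ih h.2]

theorem realPath_concat {v : V} {l : List E} {e : E} (h : G.IsPath v l (G.s e)) :
    (realPath v (l ++ [e]) : G.LeavittPathAlgebra S) = realPath v l * of (edge e) := by
  induction l generalizing v with
  | nil =>
    obtain rfl : v = G.s e := h
    simp only [List.nil_append, realPath, edge_mul_range, source_mul_edge]
  | cons f l ih => rw [List.cons_append, realPath, ih h.2, realPath, mul_assoc]

theorem ghostPath_concat {v : V} {l : List E} {e : E} (h : G.IsPath v l (G.s e)) :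
    (ghostPath v (l ++ [e]) : G.LeavittPathAlgebra S) = of (ghost e) * ghostPath v l := by
  induction l generalizing v with
  | nil =>
    obtain rfl : v = G.s e := h
    simp only [List.nil_append, ghostPath, range_mul_ghost, ghost_mul_source]
  | cons f l ih => rw [List.cons_append, ghostPath, ih h.2, ghostPath, mul_assoc]

/-- The monomial `αβ^*`. -/
noncomputable def monomial (α β : G.FinPath) : G.LeavittPathAlgebra S :=
  realPath α.src α.edges * ghostPath β.src β.edges

/-- Relation (4), transported to the common range of two paths: `αβ^* = ∑ αe(βe)^*`. -/
theorem monomial_eq_sum {α β : G.FinPath} (h : α.tgt = β.tgt) (hv : G.IsRegular α.tgt) :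
    (monomial α β : G.LeavittPathAlgebra S) = ∑ e ∈ hv.2.toFinset.attach,
      monomial (α.comp (FinPath.edge G e) ((hv.2.mem_toFinset.1 e.2).symm))
        (β.comp (FinPath.edge G e) (h.symm.trans (hv.2.mem_toFinset.1 e.2).symm)) := by
  have hsum : (monomial α β : G.LeavittPathAlgebra S) =
      realPath α.src α.edges * of (vertex α.tgt) * ghostPath β.src β.edges := by
    rw [realPath_mul_range α.isPath, monomial]
  rw [hsum, vertex_eq_sum hv, Finset.mul_sum, Finset.sum_mul, ← Finset.sum_attach]
  refine Finset.sum_congr rfl fun e _ => ?_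
  have he : G.s e = α.tgt := hv.2.mem_toFinset.1 e.2
  have hα : G.IsPath α.src α.edges (G.s e) := by rw [he]; exact α.isPath
  have hβ : G.IsPath β.src β.edges (G.s e) := by rw [he, h]; exact β.isPath
  simp only [monomial, realPath_concat hα, ghostPath_concat hβ,
    mul_assoc]

variable (G S) in
/-- The span of the monomials `αβ^*` with `r(α) = r(β)`. -/
noncomputable def monomialSpan : Submodule S (G.LeavittPathAlgebra S) :=
  Submodule.span S {a | ∃ α β : G.FinPath, α.tgt = β.tgt ∧ a = monomial α β}

theorem monomial_mem {α β : G.FinPath} (h : α.tgt = β.tgt) :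
    monomial α β ∈ monomialSpan G S :=
  Submodule.subset_span ⟨α, β, h, rfl⟩

theorem of_mem_monomialSpan (x : LeavittGen V E) : of x ∈ monomialSpan G S := by
  cases x with
  | vertex v =>
    convert monomial_mem (α := FinPath.vertex G v) (β := FinPath.vertex G v) rfl using 1
    exact (vertex_mul_self v).symm
  | edge e =>
    convert monomial_mem (α := FinPath.edge G e) (β := FinPath.vertex G (G.r e)) rfl using 1
    simp only [monomial, realPath, ghostPath, edge_mul_range]
  | ghost e =>
    convert monomial_mem (α := FinPath.vertex G (G.r e)) (β := FinPath.edge G e) rfl using 1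
    simp only [monomial, realPath, ghostPath, range_mul_ghost]

theorem of_mul_monomial_mem (x : LeavittGen V E) {α β : G.FinPath} (h : α.tgt = β.tgt) :
    of x * monomial α β ∈ monomialSpan G S := by
  have hα := source_mul_realPath (S := S) α.isPath
  cases x with
  | vertex v =>
    by_cases hv : v = α.src
    · convert monomial_mem h using 1
      rw [monomial, ← mul_assoc, hv, hα]
    · convert zero_mem (monomialSpan G S) using 1
      rw [monomial, ← mul_assoc, ← hα, ← mul_assoc, vertex_mul_vertex hv, zero_mul, zero_mul]
  | edge e =>
    by_cases hv : G.r e = α.src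
    · convert monomial_mem (α := (FinPath.edge G e).comp α hv) h using 1
      simp only [monomial, List.singleton_append, realPath, mul_assoc,
        hv]
    · convert zero_mem (monomialSpan G S) using 1
      rw [monomial, ← edge_mul_range, ← hα]
      simp only [← mul_assoc]
      rw [mul_assoc (of (edge e)), vertex_mul_vertex hv, mul_zero, zero_mul, zero_mul]
  | ghost e =>
    obtain ⟨v, l, w, hp⟩ := α
    cases l with
    | nil =>
      obtain rfl : v = w := hp
      have hβ := range_mul_ghostPath (S := S) β.isPath
      have h : v = β.tgt := h
      by_cases hv : G.s e = v
      · have hve : β.tgt = (FinPath.edge G e).src := (hv.trans h).symm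
        have hβ' : G.IsPath β.src β.edges (G.s e) := by rw [hv, h]; exact β.isPath
        convert monomial_mem (α := FinPath.vertex G (G.r e)) (β := β.comp (FinPath.edge G e) hve)
          rfl using 1
        simp only [monomial, realPath, ghostPath_concat hβ',
          ← mul_assoc, range_mul_ghost]
        rw [← hv, ghost_mul_source]
      · convert zero_mem (monomialSpan G S) using 1
        simp only [monomial, realPath, ← mul_assoc]
        rw [← ghost_mul_source, mul_assoc (of (ghost e)), vertex_mul_vertex hv, mul_zero, zero_mul]
    | cons f l =>
      by_cases hef : e = f
      · subst hef
        convert monomial_mem (α := ⟨G.r e, l, w, hp.2⟩) h using 1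
        simp only [monomial, realPath, ← mul_assoc, ghost_mul_self, source_mul_realPath hp.2]
      · convert zero_mem (monomialSpan G S) using 1
        simp only [monomial, realPath, ← mul_assoc, ghost_mul_edge hef, zero_mul]

/-- The monomials `αβ^*` span the Leavitt path algebra. -/
theorem mem_monomialSpan (a : G.LeavittPathAlgebra S) : a ∈ monomialSpan G S := by
  have hmul (x : LeavittGen V E) {b : G.LeavittPathAlgebra S} (hb : b ∈ monomialSpan G S) :
      of x * b ∈ monomialSpan G S := by
    induction hb using Submodule.span_induction with
    | mem b hb =>
      obtain ⟨α, β, h, rfl⟩ := hb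
      exact of_mul_monomial_mem x h
    | zero => rw [mul_zero]; exact zero_mem _
    | add b c _ _ ihb ihc => rw [mul_add]; exact add_mem ihb ihc
    | smul t b _ ih => rw [mul_smul_comm]; exact Submodule.smul_mem _ _ ih
  have hword (w : FreeSemigroup (LeavittGen V E)) :
      (mk (MonoidAlgebra.single w 1) : G.LeavittPathAlgebra S) ∈ monomialSpan G S := by
    induction w using FreeSemigroup.recOnMul with
    | ih1 x => exact of_mem_monomialSpan x
    | ih2 x w _ ih =>
      convert hmul x ih using 1
      refine congrArg mk (?_ : _ = (gen x * MonoidAlgebra.single w 1 : LeavittFree S V E))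
      rw [gen, MonoidAlgebra.single_mul_single, one_mul]
  obtain ⟨a, rfl⟩ := mk_surjective a
  induction a using MonoidAlgebra.induction_linear with
  | zero => exact zero_mem _
  | add f g hf hg => exact add_mem hf hg
  | single w c =>
    convert Submodule.smul_mem _ c (hword w) using 1
    refine congrArg mk (?_ : _ = (c • MonoidAlgebra.single w 1 : LeavittFree S V E))
    rw [MonoidAlgebra.smul_single, smul_eq_mul, mul_one]

end LeavittPathAlgebra

/-! ### The image of a monomial under the natural homomorphism -/

open SteinbergAlgebra LeavittPathAlgebra

theorem setMul_edge_Z (e : E) (α β : G.FinPath) (h : G.r e = α.src) :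
    setMul (Z (FinPath.edge G e) (FinPath.vertex G (G.r e))) (Z α β) =
      Z ((FinPath.edge G e).comp α h) β := by
  ext γ
  constructor
  · rintro ⟨_, ⟨x, h1, h2, rfl⟩, _, ⟨y, h3, h4, rfl⟩, hc, rfl⟩
    obtain rfl : x = concat α y h3 := (concat_of_nil rfl x h2).symm.trans hc
    refine ⟨y, h3, h4, ?_⟩
    ext1
    · exact (concat_comp ..).symm
    · simp [arr, comp, add_sub_assoc]
    · rfl
  · rintro ⟨y, h3, h4, rfl⟩
    have h3 : α.tgt = y.src := h3
    have h1 : G.r e = (concat α y h3).src := h.trans (src_concat ..).symm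
    refine ⟨arr _ _ (concat α y h3) h1 h1, arr_mem_Z .., arr α β y h3 h4, arr_mem_Z ..,
      concat_of_nil rfl _ _, ?_⟩
    ext1
    · exact (concat_comp ..).symm
    · simp [arr, comp, add_sub_assoc]
    · rfl

theorem inv_comp (g h : G.Groupoid) (hc : g.src = h.rng) :
    (g.comp h hc).inv = h.inv.comp g.inv hc.symm := by
  ext1
  · rfl
  · exact (neg_add_rev ..)
  · rfl

theorem setMul_Z_inv {α β γ δ κ η : G.FinPath} (h : setMul (Z α β) (Z γ δ) = Z κ η) :
    setMul (Z δ γ) (Z β α) = Z η κ := by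
  ext g
  rw [← inv_mem_Z, ← h]
  constructor
  · rintro ⟨a, ha, b, hb, hc, rfl⟩
    exact ⟨b.inv, inv_mem_Z.2 hb, a.inv, inv_mem_Z.2 ha, hc.symm, (inv_comp ..).symm⟩
  · rintro ⟨a, ha, b, hb, hc, hg⟩
    exact ⟨b.inv, inv_mem_Z.2 hb, a.inv, inv_mem_Z.2 ha, hc.symm, by
      rw [← inv_comp a b hc, hg, inv_inv]⟩

theorem naturalHom_realPath (α : G.FinPath) :
    G.naturalHom S (realPath α.src α.edges) = charZ α (FinPath.vertex G α.tgt) := by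
  obtain ⟨v, l, w, hp⟩ := α
  induction l generalizing v with
  | nil =>
    obtain rfl : v = w := hp
    exact G.naturalHom_gen S (vertex v)
  | cons e l ih =>
    obtain ⟨rfl, hl⟩ := hp
    refine (map_mul (G.naturalHom S) _ _).trans ?_
    rw [ih (G.r e) hl]
    exact (congrArg (· * _) (G.naturalHom_gen S (edge e))).trans
      (charZ_mul (setMul_edge_Z e ⟨G.r e, l, w, hl⟩ _ rfl))

theorem naturalHom_ghostPath (α : G.FinPath) :
    G.naturalHom S (ghostPath α.src α.edges) = charZ (FinPath.vertex G α.tgt) α := by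
  obtain ⟨v, l, w, hp⟩ := α
  induction l generalizing v with
  | nil =>
    obtain rfl : v = w := hp
    exact G.naturalHom_gen S (vertex v)
  | cons e l ih =>
    obtain ⟨rfl, hl⟩ := hp
    refine (map_mul (G.naturalHom S) _ _).trans ?_
    rw [ih (G.r e) hl]
    exact (congrArg (_ * ·) (G.naturalHom_gen S (ghost e))).trans
      (charZ_mul (setMul_Z_inv (setMul_edge_Z e ⟨G.r e, l, w, hl⟩ _ rfl)))

theorem naturalHom_monomial {α β : G.FinPath} (h : α.tgt = β.tgt) :
    G.naturalHom S (monomial α β) = charZ α β := by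
  rw [monomial, map_mul, naturalHom_realPath, naturalHom_ghostPath, ← h]
  exact charZ_mul (setMul_Z α (FinPath.vertex G α.tgt) β rfl)

end Monomials

end DirGraph

/-! ### The Boolean semifield -/

namespace BooleanSemifield

theorem add_ne_zero_iff : ∀ {a b : BooleanSemifield}, a + b ≠ 0 ↔ a ≠ 0 ∨ b ≠ 0 := by decide

theorem eq_iff_ne_zero_iff : ∀ {a b : BooleanSemifield}, a = b ↔ (a ≠ 0 ↔ b ≠ 0) := by decide

theorem eq_zero_or_one : ∀ a : BooleanSemifield, a = 0 ∨ a = 1 := by decide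

theorem indicator_ne_zero_iff {X : Type*} {U : Set X} {x : X} :
    (U.indicator 1 x : BooleanSemifield) ≠ 0 ↔ x ∈ U :=
  Set.indicator_apply_ne_zero.trans (and_iff_left (by decide : (1 : BooleanSemifield) ≠ 0))

end BooleanSemifield

namespace DirGraph

open Set Groupoid BoundaryPath LeavittFree LeavittGen LeavittPathAlgebra

section Boolean

variable {V E : Type*} {G : DirGraph V E}

/-! ### Boundary paths -/

namespace BoundaryPath

/-- Every vertex is the source of a path in `X_E`: a walk from `v` can be prolonged until it reaches
a sink or an infinite emitter, or else forever. -/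
theorem exists_src_eq (G : DirGraph V E) (v : V) : ∃ x : G.BoundaryPath, x.src = v := by
  by_cases h : ∃ p : G.FinPath, p.src = v ∧ (G.IsSink p.tgt ∨ G.IsInfiniteEmitter p.tgt)
  · obtain ⟨p, rfl, hp⟩ := h
    exact ⟨fin p hp, rfl⟩
  · push Not at h
    have hstep (p : {p : G.FinPath // p.src = v}) : ∃ e, G.s e = p.1.tgt :=
      nonempty_iff_ne_empty.2 (h p.1 p.2).1
    choose e he using hstep
    let next (p : {p : G.FinPath // p.src = v}) : {p : G.FinPath // p.src = v} :=
      ⟨p.1.comp (FinPath.edge G (e p)) (he p).symm, p.2⟩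
    let p (n : ℕ) : {p : G.FinPath // p.src = v} := next^[n] ⟨FinPath.vertex G v, rfl⟩
    refine ⟨inf (fun n => e (p n)) fun n => ?_, he _⟩
    rw [he, show p (n + 1) = next (p n) from Function.iterate_succ_apply' ..]

theorem edges_eq_nil_of_fin_vertex_eq {v : V} {h} {μ : G.FinPath} {y : G.BoundaryPath} {hy}
    (hx : fin (FinPath.vertex G v) h = concat μ y hy) : μ.edges = [] := by
  cases y with
  | fin p hp =>
    have := congrArg FinPath.edges (BoundaryPath.fin.inj hx)
    exact (List.append_eq_nil_iff.1 this.symm).1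
  | inf y hy => cases hx

end BoundaryPath

/-! ### The order on the Leavitt path algebra -/

namespace LeavittPathAlgebra

/-- Addition in `L_𝔹(E)` is idempotent, hence the join of a partial order: `a ≤ b` means
`a + b = b`. -/
noncomputable instance : SemilatticeSup (G.LeavittPathAlgebra BooleanSemifield) :=
  letI : Max (G.LeavittPathAlgebra BooleanSemifield) := ⟨(· + ·)⟩
  SemilatticeSup.mk' add_comm add_assoc fun a => by
    have h : (1 + 1 : BooleanSemifield) • a = (1 : BooleanSemifield) • a := rfl
    rwa [add_smul, one_smul] at h

theorem zero_le (a : G.LeavittPathAlgebra BooleanSemifield) : 0 ≤ a := zero_add a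

theorem sum_le {ι : Type*} {s : Finset ι} {f : ι → G.LeavittPathAlgebra BooleanSemifield}
    {b : G.LeavittPathAlgebra BooleanSemifield} (h : ∀ i ∈ s, f i ≤ b) : ∑ i ∈ s, f i ≤ b :=
  Finset.sum_induction f (· ≤ b) (fun _ _ => sup_le) (zero_le b) h

theorem le_sum {ι : Type*} {s : Finset ι} {f : ι → G.LeavittPathAlgebra BooleanSemifield} {i : ι}
    (h : i ∈ s) : f i ≤ ∑ i ∈ s, f i := by
  classical
  rw [← Finset.add_sum_erase s f h]
  exact le_sup_left

/-- `αμ(βμ)^* ≤ αβ^*`. This needs relation (4) at every vertex on `μ`, except the last one. -/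
theorem monomial_comp_le (hG : G.RowFinite) (α β μ : G.FinPath) (hα : α.tgt = μ.src)
    (hβ : β.tgt = μ.src) :
    (monomial (α.comp μ hα) (β.comp μ hβ) : G.LeavittPathAlgebra BooleanSemifield) ≤
      monomial α β := by
  obtain ⟨v, l, w, hp⟩ := μ
  induction l generalizing α β v with
  | nil => rw [FinPath.comp_of_nil hα rfl, FinPath.comp_of_nil hβ rfl]
  | cons e l ih =>
    obtain ⟨rfl, hl⟩ := hp
    have hassoc (γ : G.FinPath) (hγ : γ.tgt = G.s e) :
        γ.comp ⟨G.s e, e :: l, w, rfl, hl⟩ hγ =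
          (γ.comp (FinPath.edge G e) hγ).comp ⟨G.r e, l, w, hl⟩ rfl :=
      FinPath.ext' rfl (by simp)
    rw [hassoc α hα, hassoc β hβ]
    refine (ih _ _ _ hl rfl rfl).trans ?_
    have hv : G.IsRegular α.tgt := ⟨⟨e, hα.symm⟩, hG _⟩
    rw [monomial_eq_sum (hα.trans hβ.symm) hv]
    exact le_sum (f := fun e : {e // e ∈ hv.2.toFinset} =>
      (monomial (α.comp (FinPath.edge G e.1) (hv.2.mem_toFinset.1 e.2).symm)
        (β.comp (FinPath.edge G e.1) _) : G.LeavittPathAlgebra BooleanSemifield))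
      (Finset.mem_attach _ ⟨e, hv.2.mem_toFinset.2 hα.symm⟩)

theorem monomial_le_of_arr_mem_Z (hG : G.RowFinite) {α β γ δ : G.FinPath} {x : G.BoundaryPath}
    {hα hβ} (h : arr α β x hα hβ ∈ Z γ δ) (hle : γ.length ≤ α.length) :
    (monomial α β : G.LeavittPathAlgebra BooleanSemifield) ≤ monomial γ δ := by
  obtain ⟨y, h1, h2, h3⟩ := h
  obtain ⟨μ, h4, h5, -, rfl, rfl, -⟩ := arr_eq_arr h3 hle
  exact monomial_comp_le hG γ δ μ h4 h5

/-- The order between monomials is detected by the sets `Z(α, β)`. The number `n` bounds how far the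
path `α` has to be prolonged, by means of relation (4), before each of the resulting sets lies in a
single one of the sets that cover `Z(α, β)`. -/
theorem monomial_le_of_Z_subset (hG : G.RowFinite) {b : G.LeavittPathAlgebra BooleanSemifield}
    {T : Set (G.FinPath × G.FinPath)} (hT : ∀ p ∈ T, monomial p.1 p.2 ≤ b) (n : ℕ)
    {α β : G.FinPath} (h : α.tgt = β.tgt) (hZ : Z α β ⊆ ⋃ p ∈ T, Z p.1 p.2)
    (hlen : ∀ p ∈ T, p.1.length ≤ α.length + n) : monomial α β ≤ b := by
  induction n generalizing α β with
  | zero =>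
    obtain ⟨x, hx⟩ := exists_src_eq G α.tgt
    obtain ⟨p, hp, hxp⟩ := mem_iUnion₂.1 (hZ (arr_mem_Z α β x hx.symm (h.symm.trans hx.symm)))
    exact (monomial_le_of_arr_mem_Z hG hxp (hlen p hp)).trans (hT p hp)
  | succ n ih =>
    by_cases hv : G.IsSink α.tgt
    · let x : G.BoundaryPath := fin (FinPath.vertex G α.tgt) (Or.inl hv)
      obtain ⟨p, hp, hxp⟩ := mem_iUnion₂.1 (hZ (arr_mem_Z α β x rfl h.symm))
      refine (monomial_le_of_arr_mem_Z hG hxp ?_).trans (hT p hp)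
      by_contra! hlt
      obtain ⟨y, h1, h2, h3⟩ := hxp
      obtain ⟨μ, h4, -, h5, h6, -, h7⟩ := arr_eq_arr h3.symm hlt.le
      rw [h6, FinPath.comp_of_nil h4 (edges_eq_nil_of_fin_vertex_eq h7)] at hlt
      exact hlt.false
    · have hv : G.IsRegular α.tgt := ⟨nonempty_iff_ne_empty.2 hv, hG _⟩
      rw [monomial_eq_sum h hv]
      refine sum_le fun e _ => ih rfl ((Z_comp_subset ..).trans hZ) fun p hp => ?_
      rw [FinPath.length_comp, FinPath.length_edge]
      exact (hlen p hp).trans (by omega)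

/-- Over `𝔹` every element is a sum of monomials with coefficients `1`. -/
theorem exists_list_monomial (a : G.LeavittPathAlgebra BooleanSemifield) :
    ∃ l : List (G.FinPath × G.FinPath), (∀ p ∈ l, p.1.tgt = p.2.tgt) ∧
      a = (l.map fun p => monomial p.1 p.2).sum := by
  induction mem_monomialSpan a using Submodule.span_induction with
  | mem a ha =>
    obtain ⟨α, β, h, rfl⟩ := ha
    exact ⟨[(α, β)], by simpa using h, by simp⟩
  | zero => exact ⟨[], by simp, rfl⟩
  | add a b _ _ iha ihb =>
    obtain ⟨l, hl, rfl⟩ := iha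
    obtain ⟨m, hm, rfl⟩ := ihb
    exact ⟨l ++ m, fun p hp => (List.mem_append.1 hp).elim (hl p) (hm p), by simp⟩
  | smul c a _ ih =>
    rcases BooleanSemifield.eq_zero_or_one c with rfl | rfl
    · exact ⟨[], by simp, zero_smul ..⟩
    · rwa [one_smul]

end LeavittPathAlgebra

/-! ### Supports -/

/-- The support of the function `π_E(a)`, which determines it since its values are `0` or `1`. -/
def naturalSupport (a : G.LeavittPathAlgebra BooleanSemifield) : Set G.Groupoid :=
  {g | (G.naturalHom BooleanSemifield a).1 g ≠ 0}

theorem naturalSupport_zero :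
    naturalSupport (0 : G.LeavittPathAlgebra BooleanSemifield) = ∅ := by
  ext g
  simp only [naturalSupport, map_zero]
  exact iff_of_false (fun h => h rfl) id

theorem naturalSupport_add (a b : G.LeavittPathAlgebra BooleanSemifield) :
    naturalSupport (a + b) = naturalSupport a ∪ naturalSupport b := by
  ext g
  simp only [naturalSupport, map_add]
  exact BooleanSemifield.add_ne_zero_iff

theorem naturalSupport_monomial {α β : G.FinPath} (h : α.tgt = β.tgt) :
    naturalSupport (monomial α β) = Z α β := by
  ext g
  simp only [naturalSupport, naturalHom_monomial h]
  exact BooleanSemifield.indicator_ne_zero_iff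

theorem naturalSupport_list_sum {l : List (G.FinPath × G.FinPath)}
    (hl : ∀ p ∈ l, p.1.tgt = p.2.tgt) :
    naturalSupport (l.map fun p => monomial p.1 p.2).sum = ⋃ p ∈ {p | p ∈ l}, Z p.1 p.2 := by
  induction l with
  | nil => simpa using naturalSupport_zero
  | cons p l ih =>
    rw [List.map_cons, List.sum_cons, naturalSupport_add, ih fun q hq => hl q (.tail _ hq),
      naturalSupport_monomial (hl p (.head _))]
    ext g
    simp

theorem coe_naturalHom_eq {a : G.LeavittPathAlgebra BooleanSemifield} {U : Set G.Groupoid}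
    (h : naturalSupport a = U) : (G.naturalHom BooleanSemifield a).1 = U.indicator 1 := by
  funext g
  rw [BooleanSemifield.eq_iff_ne_zero_iff]
  exact (Set.ext_iff.1 h g).trans BooleanSemifield.indicator_ne_zero_iff.symm

/-! ### Row-finite graphs -/

theorem le_of_naturalSupport_subset (hG : G.RowFinite)
    {a b : G.LeavittPathAlgebra BooleanSemifield} (h : naturalSupport a ⊆ naturalSupport b) :
    a ≤ b := by
  obtain ⟨m, hm, hb⟩ := exists_list_monomial b
  have hT : ∀ p ∈ {p | p ∈ m}, monomial p.1 p.2 ≤ b := by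
    rw [hb]
    clear hb hm h
    induction m with
    | nil => simp
    | cons q m ih =>
      rintro p (_ | ⟨_, hp⟩)
      · exact le_sup_left
      · exact (ih p hp).trans le_sup_right
  rw [hb, naturalSupport_list_sum hm] at h
  induction mem_monomialSpan a using Submodule.span_induction with
  | mem a ha =>
    obtain ⟨α, β, hαβ, rfl⟩ := ha
    rw [naturalSupport_monomial hαβ] at h
    refine monomial_le_of_Z_subset hG hT (m.map fun p => p.1.length).sum hαβ h fun p hp => ?_
    have hp' : p.1.length ∈ m.map fun p => p.1.length :=
      List.mem_map_of_mem (f := fun p => p.1.length) hp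
    exact (List.single_le_sum (fun _ _ => Nat.zero_le _) _ hp').trans (Nat.le_add_left ..)
  | zero => exact zero_le b
  | add a a' _ _ ih ih' =>
    rw [naturalSupport_add, union_subset_iff] at h
    exact sup_le (ih h.1) (ih' h.2)
  | smul c a _ ih =>
    rcases BooleanSemifield.eq_zero_or_one c with rfl | rfl
    · rw [zero_smul]
      exact zero_le b
    · rw [one_smul] at h ⊢
      exact ih h

theorem naturalHom_injective (hG : G.RowFinite) :
    Function.Injective (G.naturalHom BooleanSemifield) := by
  intro a b h
  have h : naturalSupport a = naturalSupport b := by rw [naturalSupport, h, naturalSupport]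
  exact le_antisymm (le_of_naturalSupport_subset hG h.subset)
    (le_of_naturalSupport_subset hG h.symm.subset)

/-- If `E` is row-finite, then the sets `Z(α, β)` form a base of the topology of `𝒢_E`. -/
theorem exists_Z_subset (hG : G.RowFinite) {U : Set G.Groupoid} (hU : IsOpen U) {g : G.Groupoid}
    (hg : g ∈ U) : ∃ α β : G.FinPath, α.tgt = β.tgt ∧ g ∈ Z α β ∧ Z α β ⊆ U := by
  obtain ⟨α, β, x, hα, hβ, rfl⟩ := g.exists_arr
  obtain ⟨μ, y, hy, h1, h2, F, rfl, hF, h4, h5⟩ := exists_ZF_subset hU _ _ _ _ _ hg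
  rw [← arr_comp α β μ y h1 h2 hy]
  rcases y.cases_edge with ⟨hs, -⟩ | ⟨e, z, hz, rfl⟩
  · have hs : G.s ⁻¹' {y.src} = ∅ := hs.resolve_right fun h => h (hG _)
    obtain rfl : F = ∅ := by
      refine Finset.eq_empty_of_forall_notMem fun e he => ?_
      exact eq_empty_iff_forall_notMem.1 hs e ((hF e he).trans hy)
    rw [ZF_empty] at h5
    exact ⟨α.comp μ h1, β.comp μ h2, rfl, arr_mem_Z .., h5⟩
  · have h6 : μ.tgt = (FinPath.edge G e).src := hy.trans (src_concat _ _ _)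
    have h7 : arr (α.comp μ h1) (β.comp μ h2) (concat (FinPath.edge G e) z hz) hy hy ∈
        Z ((α.comp μ h1).comp (FinPath.edge G e) h6) ((β.comp μ h2).comp (FinPath.edge G e) h6) :=
      ⟨z, hz, hz, (arr_comp ..).symm⟩
    exact ⟨(α.comp μ h1).comp (FinPath.edge G e) h6, (β.comp μ h2).comp (FinPath.edge G e) h6, rfl,
      h7, (Z_comp_subset_ZF (List.cons_ne_nil _ _) h7 h4).trans h5⟩

theorem naturalHom_surjective (hG : G.RowFinite) :
    Function.Surjective (G.naturalHom BooleanSemifield) := by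
  have key (f : G.Groupoid → BooleanSemifield) (hf : f ∈ G.steinbergModule BooleanSemifield) :
      ∃ a, (G.naturalHom BooleanSemifield a).1 = f := by
    induction hf using Submodule.span_induction with
    | mem f hf =>
      obtain ⟨U, hU, rfl⟩ := hf
      suffices ∃ a : G.LeavittPathAlgebra BooleanSemifield,
          U ⊆ naturalSupport a ∧ naturalSupport a ⊆ U from
        this.imp fun a ha => coe_naturalHom_eq (ha.2.antisymm ha.1)
      refine hU.1.induction_on (p := fun s => ∃ a : G.LeavittPathAlgebra BooleanSemifield,
          s ⊆ naturalSupport a ∧ naturalSupport a ⊆ U) ⟨0, empty_subset _, ?_⟩ ?_ ?_ ?_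
      · rw [naturalSupport_zero]
        exact empty_subset _
      · rintro s t hst ⟨a, h1, h2⟩
        exact ⟨a, hst.trans h1, h2⟩
      · rintro s t ⟨a, h1, h2⟩ ⟨b, h3, h4⟩
        refine ⟨a + b, ?_, ?_⟩ <;> rw [naturalSupport_add]
        · exact union_subset_union h1 h3
        · exact union_subset h2 h4
      · intro g hg
        obtain ⟨α, β, h, hgZ, hZU⟩ := exists_Z_subset hG hU.2.1 hg
        refine ⟨Z α β, mem_nhdsWithin_of_mem_nhds ((isOpen_Z α β).mem_nhds hgZ), monomial α β, ?_⟩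
        rw [naturalSupport_monomial h]
        exact ⟨Subset.rfl, hZU⟩
    | zero => exact ⟨0, by rw [map_zero]; rfl⟩
    | add f g _ _ ihf ihg =>
      obtain ⟨a, rfl⟩ := ihf
      obtain ⟨b, rfl⟩ := ihg
      exact ⟨a + b, by rw [map_add]; rfl⟩
    | smul c f _ ih =>
      obtain ⟨a, rfl⟩ := ih
      exact ⟨c • a, by rw [map_smul]; rfl⟩
  exact fun f => (key f.1 f.2).imp fun a ha => Subtype.ext ha

/-! ### Infinite emitters -/

theorem isCompactOpenBisection_ZF {α β : G.FinPath} {F : Finset E} (h : α.tgt = β.tgt)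
    (hF : ∀ e ∈ F, G.s e = α.tgt) : IsCompactOpenBisection (ZF α β F) := by
  have hZ := isOpenBisection_iff.1 (isCompactOpenBisection_Z α β).2
  have hsub : ZF α β F ⊆ Z α β := sdiff_subset
  refine ⟨isCompact_Z.diff ?_,
    isOpenBisection_iff.2 ⟨isOpen_ZF h hF, hZ.2.1.mono hsub, hZ.2.2.mono hsub⟩⟩
  refine isOpen_iff_forall_mem_open.2 ?_
  rintro g ⟨e, he, hα, hβ, hg⟩
  exact ⟨_, fun g' hg' => ⟨e, he, hα, hβ, hg'⟩, isOpen_Z _ _, hg⟩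

/-- If `v`, as a path of length `0`, belongs to `X_E`, then the only one of the sets `Z(α, β)` that
contains the unit at this path is `Z(v, v)`. -/
theorem Z_vertex_subset_naturalSupport {v : V} (hv : G.IsSink v ∨ G.IsInfiniteEmitter v)
    {a : G.LeavittPathAlgebra BooleanSemifield}
    (ha : arr (FinPath.vertex G v) (FinPath.vertex G v) (fin (FinPath.vertex G v) hv) rfl rfl ∈
      naturalSupport a) :
    Z (FinPath.vertex G v) (FinPath.vertex G v) ⊆ naturalSupport a := by
  induction mem_monomialSpan a using Submodule.span_induction with
  | mem a h =>
    obtain ⟨α, β, hαβ, rfl⟩ := h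
    rw [naturalSupport_monomial hαβ] at ha ⊢
    obtain ⟨y, h1, h2, h3⟩ := ha
    obtain ⟨μ, h4, h5, h6, rfl, rfl, h7⟩ := arr_eq_arr h3.symm (Nat.zero_le _)
    rw [FinPath.comp_of_nil h4 (edges_eq_nil_of_fin_vertex_eq h7)]
  | zero =>
    rw [naturalSupport_zero] at ha
    exact ha.elim
  | add a b _ _ iha ihb =>
    rw [naturalSupport_add] at ha ⊢
    exact ha.elim (fun h => (iha h).trans subset_union_left)
      fun h => (ihb h).trans subset_union_right
  | smul c a _ ih =>
    rcases BooleanSemifield.eq_zero_or_one c with rfl | rfl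
    · rw [zero_smul, naturalSupport_zero] at ha
      exact ha.elim
    · rw [one_smul] at ha ⊢
      exact ih ha

theorem rowFinite_of_naturalHom_surjective
    (h : Function.Surjective (G.naturalHom BooleanSemifield)) : G.RowFinite := by
  intro v
  by_contra hv
  have hv : G.IsInfiniteEmitter v := hv
  obtain ⟨e, rfl⟩ := hv.nonempty
  -- The characteristic function of `Z(v, v) \ Z(e, e)` is not in the image.
  have hU : IsCompactOpenBisection
      (ZF (FinPath.vertex G (G.s e)) (FinPath.vertex G (G.s e)) {e}) :=
    isCompactOpenBisection_ZF rfl (by simp)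
  obtain ⟨a, ha⟩ := h ⟨_, indicator_mem hU⟩
  have hsupp : naturalSupport a =
      ZF (FinPath.vertex G (G.s e)) (FinPath.vertex G (G.s e)) {e} := by
    ext g
    simp only [naturalSupport, ha]
    exact BooleanSemifield.indicator_ne_zero_iff
  have hsub := Z_vertex_subset_naturalSupport (a := a) (Or.inr hv) (by
    rw [hsupp]
    refine arr_mem_ZF_iff.2 ?_
    intro f _ y hy hx
    exact List.cons_ne_nil _ _ (edges_eq_nil_of_fin_vertex_eq hx))
  obtain ⟨y, hy⟩ := exists_src_eq G (G.r e)
  have hx : G.s e = (concat (FinPath.edge G e) y hy.symm).src :=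
    (src_concat (FinPath.edge G e) y hy.symm).symm
  have hmem := hsub (arr_mem_Z _ _ _ hx hx)
  rw [hsupp, arr_mem_ZF_iff] at hmem
  exact hmem e (Finset.mem_singleton_self e) y hy.symm rfl

end Boolean

end DirGraph

theorem mainTheorem3 {V E : Type*} (G : DirGraph V E) :
    Function.Bijective (G.naturalHom BooleanSemifield) ↔ G.RowFinite :=
  ⟨fun h => DirGraph.rowFinite_of_naturalHom_surjective h.2,
    fun h => ⟨DirGraph.naturalHom_injective h, DirGraph.naturalHom_surjective h⟩⟩
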